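/- Let $\operatorname{erf}(x)=\frac1{\sqrt\pi}\int_{-x}^{x}e^{-t^2}\,dt$. For integers $k\ge 1$, $d$ and $w_0\in\mathbb R^d$ consider the weight-sharing predictor $$p^{(1,k)}_{w_0}(x)=\operatorname{erf}(w_0^\top x_1)+\prod_{l=1}^{k}\operatorname{erf}(w_0^\top x_l),\qquad x=(x_1,\dots,x_k)\in(\mathbb R^d)^k .$$ For a target vector $u_0\in\mathbb R^d$ let $$F^{(1,k)}(w_0)=\mathbb E_x\Big[\tfrac12\big(p^{(1,k)}_{w_0}(x)-p^{(1,k)}_{u_0}(x)\big)^2\Big],$$ where $x_1,\dots,x_k$ are i.i.d. standard Gaussian vectors in $\mathbb R^d$. Gradient descent (GD) with constant learning rate $\eta$ is the iteration $w_0^{(t+1)}=w_0^{(t)}-\eta\nabla F^{(1,k)}(w_0^{(t)})$; in projected GD every step is followed by the Euclidean projection onto the ball $\{\|w\|\le\|u_0\|\}$. **Theorem.** There are absolute constants $C,m$ such that for every $k\ge1$ and every $\epsilon>0$ there are a learning rate $\eta>0$ and a number of iterations $T\le C\,(k+1/\epsilon)^m$, both depending only on $k$ and $\epsilon$, with the following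 property. Let $d$ be any dimension, let $u_0\in\mathbb R^d$ satisfy $\|u_0\|^2=\frac{12}{\pi^2}k^2$, and let the initial point $w_0^{(0)}\in\mathbb R^d$ satisfy $u_0^\top w_0^{(0)}>0$. 1. If $\|w_0^{(0)}\|\le\|u_0\|$, then projected GD with constant learning rate $\eta$ satisfies $\|w_0^{(T)}-u_0\|\le\epsilon$. 2. If the iterates of plain GD with constant learning rate $\eta$ satisfy $\|w_0^{(t)}\|\le\|u_0\|$ for all $0\le t\le T$, then they satisfy $\|w_0^{(T)}-u_0\|\le\epsilon$. -/

import Mathlib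

noncomputable section

namespace WeightSharing

open MeasureTheory ProbabilityTheory
open scoped Gradient RealInnerProductSpace

/-- The activation: the error function `erf x = (1/√π) ∫_{-x}^{x} exp(-t²) dt`. -/
def erf (x : ℝ) : ℝ := (1 / √Real.pi) * ∫ t in (-x)..x, Real.exp (-t ^ 2)

/-- `ℝ^d` with the Euclidean norm. -/
abbrev Vec (d : ℕ) : Type := EuclideanSpace ℝ (Fin d)

/-- The fully connected degree-`k` predictor `p^{(k)}_w(x) = ∏_l σ(w_l · x_l)`. -/
def parityPredictor {d k : ℕ} (w x : Fin k → Vec d) : ℝ := ∏ l, erf ⟪w l, x l⟫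

/-- The fully connected predictor `p^{(1,k)}_w(x) = σ(w_1 · x_1) + ∏_l σ(w_l · x_l)`
(the first patch has index `0`). -/
def sumPredictor {d k : ℕ} [NeZero k] (w x : Fin k → Vec d) : ℝ :=
  erf ⟪w 0, x 0⟫ + parityPredictor w x

/-- The weight-sharing predictor: all `k` weight vectors are equal to `w₀`. -/
def sumPredictorWS {d : ℕ} (k : ℕ) [NeZero k] (w₀ : Vec d) (x : Fin k → Vec d) : ℝ :=
  sumPredictor (fun _ => w₀) x

/-- The law of the input `x = (x_1, …, x_k)`: i.i.d. standard Gaussian vectors of `ℝ^d`. -/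
def inputLaw (d k : ℕ) : Measure (Fin k → Vec d) := Measure.pi fun _ => stdGaussian (Vec d)

/-- The objective `F^{(1,k)}` for the weight-sharing architecture and the target `p^{(1,k)}_{u₀}`,
as a function of the single weight vector `w₀`. -/
def objective {d : ℕ} (k : ℕ) [NeZero k] (u₀ w₀ : Vec d) : ℝ :=
  ∫ x, (1 / 2) * (sumPredictorWS k w₀ x - sumPredictorWS k u₀ x) ^ 2 ∂(inputLaw d k)

/-- Euclidean projection onto the closed ball of radius `r` about the origin. -/
def projBall {d : ℕ} (r : ℝ) (v : Vec d) : Vec d := if ‖v‖ ≤ r then v else (r / ‖v‖) • v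

/-- One gradient step with learning rate `η` on `F^{(1,k)}`. -/
def gdStep {d : ℕ} (k : ℕ) [NeZero k] (η : ℝ) (u₀ w : Vec d) : Vec d :=
  w - η • ∇ (objective k u₀) w

/-- The `t`-th iterate of gradient descent with constant learning rate `η`, started at `w`. -/
def gdIter {d : ℕ} (k : ℕ) [NeZero k] (η : ℝ) (u₀ w : Vec d) (t : ℕ) : Vec d :=
  (gdStep k η u₀)^[t] w

/-- The `t`-th iterate of projected gradient descent with constant learning rate `η`, started
at `w`: each gradient step is followed by projection onto the ball of radius `‖u₀‖`. -/
def projGdIter {d : ℕ} (k : ℕ) [NeZero k] (η : ℝ) (u₀ w : Vec d) (t : ℕ) : Vec d :=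
  (fun v => projBall ‖u₀‖ (gdStep k η u₀ v))^[t] w

end WeightSharing

end

noncomputable section

namespace WeightSharing

open MeasureTheory ProbabilityTheory
open scoped Gradient RealInnerProductSpace

/-! Gaussian integration gives `E[erf(w·x) erf(u·x)]` in closed form (`kern`), and independence of
the patches turns the objective into `φ(kern w w)/2 + φ(kern u u)/2 - φ(kern w u)` with `φ(y) = c y
+ y^k` (`objective_eq`). Hence, up to the factor `4/π`, the gradient is `A w - Q u` with explicit
scalars `A`, `Q`, both positive when `‖w‖ ≤ ‖u‖` and `⟪w, u⟫ > 0`. The linear summand keeps `φ' ≥ 1`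
on nonnegative correlations, so `A` and `Q` are at least inverse-polynomial in `k` even where the
product term is exponentially flat.

A step of size `h` maps `w` to `(1 - hA) w + hQ u`. It preserves `⟪w, u⟫ > 0` and multiplies the
Gram determinant `‖w‖²‖u‖² - ⟪w, u⟫²` by `(1 - hA)²`. The gradient is also correlated with `w - u`,
up to an error proportional to the Gram determinant (`inner_scaledGrad_ge`). The squared distance
plus a large multiple of the Gram determinant therefore contracts up to `O(h²)`
(`lyapunov_step_le`), and projection does not increase it (`lyapunov_projBall_le`). A small enough
step and polynomially many iterations finish the projected case; plain GD that stays in the ball is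
the same sequence. -/

/-! ### The error function and one-dimensional Gaussian integrals -/

lemma hasDerivAt_erf (x : ℝ) : HasDerivAt erf (2 / √Real.pi * Real.exp (-x ^ 2)) x := by
  have hc : Continuous fun t : ℝ => Real.exp (-t ^ 2) := by fun_prop
  have h1 : ∀ y, HasDerivAt (fun y : ℝ => ∫ t in (0 : ℝ)..y, Real.exp (-t ^ 2))
      (Real.exp (-y ^ 2)) y := fun y =>
    intervalIntegral.integral_hasDerivAt_right (hc.intervalIntegrable _ _)
      (hc.stronglyMeasurableAtFilter _ _) hc.continuousAt
  have h2 := (h1 (-x)).comp x (hasDerivAt_neg x)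
  have h3 := ((h1 x).sub h2).const_mul (1 / √Real.pi)
  have h4 : erf = fun x => 1 / √Real.pi * ((∫ t in (0 : ℝ)..x, Real.exp (-t ^ 2)) -
      ∫ t in (0 : ℝ)..(-x), Real.exp (-t ^ 2)) := by
    funext y
    rw [erf, intervalIntegral.integral_interval_sub_left (hc.intervalIntegrable _ _)
      (hc.intervalIntegrable _ _)]
  rw [h4]
  refine h3.congr_deriv ?_
  rw [neg_sq]
  ring

lemma continuous_erf : Continuous erf :=
  continuous_iff_continuousAt.2 fun x => (hasDerivAt_erf x).continuousAt

@[fun_prop]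
lemma measurable_erf : Measurable erf := continuous_erf.measurable

lemma erf_neg (x : ℝ) : erf (-x) = -erf x := by
  rw [erf, erf, neg_neg, intervalIntegral.integral_symm]
  ring

lemma erf_zero : erf 0 = 0 := by simp [erf]

lemma abs_erf_le_one (x : ℝ) : |erf x| ≤ 1 := by
  wlog hx : 0 ≤ x generalizing x
  · simpa [erf_neg] using this (-x) (by linarith)
  have hi : Integrable fun t : ℝ => Real.exp (-t ^ 2) := by
    simpa using integrable_exp_neg_mul_sq one_pos
  have hg : ∫ t : ℝ, Real.exp (-t ^ 2) = √Real.pi := by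
    simpa using integral_gaussian 1
  have hpos : 0 < √Real.pi := Real.sqrt_pos.2 Real.pi_pos
  rw [erf, intervalIntegral.integral_of_le (by linarith), abs_of_nonneg, div_mul_eq_mul_div, one_mul,
    div_le_one hpos, ← hg]
  · exact setIntegral_le_integral hi (ae_of_all _ fun t => (Real.exp_pos _).le)
  · exact mul_nonneg (by positivity) (integral_nonneg fun t => (Real.exp_pos _).le)

lemma integral_comp_neg_gaussianReal (f : ℝ → ℝ) :
    ∫ g, f (-g) ∂(gaussianReal 0 1) = ∫ g, f g ∂(gaussianReal 0 1) := by
  have h := gaussianReal_map_neg (μ := 0) (v := 1)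
  rw [neg_zero] at h
  conv_rhs => rw [← h]
  exact ((MeasurableEquiv.neg ℝ).measurableEmbedding.integral_map f).symm

lemma integral_eq_zero_of_odd {f : ℝ → ℝ} (hf : ∀ g, f (-g) = -f g) :
    ∫ g, f g ∂(gaussianReal 0 1) = 0 := by
  have h := integral_comp_neg_gaussianReal f
  simp_rw [hf, integral_neg] at h
  linarith

lemma integral_gaussianReal_std (f : ℝ → ℝ) :
    ∫ g, f g ∂(gaussianReal 0 1) = (√(2 * Real.pi))⁻¹ * ∫ g, Real.exp (-g ^ 2 / 2) * f g := by
  rw [integral_gaussianReal_eq_integral_smul one_ne_zero, ← integral_const_mul]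
  congr 1
  funext g
  simp [gaussianPDFReal, mul_assoc]

/-- Complete the square in `g` and translate. -/
lemma integral_exp_neg_add_sq (m τ : ℝ) :
    ∫ g, Real.exp (-(m + τ * g) ^ 2) ∂(gaussianReal 0 1) =
      (√(1 + 2 * τ ^ 2))⁻¹ * Real.exp (-(m / √(1 + 2 * τ ^ 2)) ^ 2) := by
  have hτ : 0 < 1 + 2 * τ ^ 2 := by positivity
  have h : ∀ g : ℝ, Real.exp (-g ^ 2 / 2) * Real.exp (-(m + τ * g) ^ 2) =
      Real.exp (-(m / √(1 + 2 * τ ^ 2)) ^ 2) *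
        Real.exp (-(1 / 2 + τ ^ 2) * (g + 2 * m * τ / (1 + 2 * τ ^ 2)) ^ 2) := by
    intro g
    rw [← Real.exp_add, ← Real.exp_add, div_pow, Real.sq_sqrt hτ.le]
    congr 1
    field_simp
    ring
  rw [integral_gaussianReal_std]
  simp_rw [h]
  rw [integral_const_mul,
    integral_add_right_eq_self (fun g : ℝ => Real.exp (-(1 / 2 + τ ^ 2) * g ^ 2)),
    integral_gaussian]
  have : Real.pi / (1 / 2 + τ ^ 2) = (2 * Real.pi) / (1 + 2 * τ ^ 2) := by
    field_simp
  rw [this, Real.sqrt_div (by positivity)]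
  have : √(2 * Real.pi) ≠ 0 := by positivity
  field_simp

lemma eq_of_hasDerivAt_of_eq_zero {f g f' : ℝ → ℝ} (hf : ∀ x, HasDerivAt f (f' x) x)
    (hg : ∀ x, HasDerivAt g (f' x) x) (h0 : f 0 = g 0) (x : ℝ) : f x = g x := by
  have hd : ∀ x, HasDerivAt (fun x => f x - g x) 0 x := fun x =>
    ((hf x).sub (hg x)).congr_deriv (sub_self _)
  have := is_const_of_deriv_eq_zero (fun x => (hd x).differentiableAt) (fun x => (hd x).deriv) x 0
  linarith

lemma two_div_sqrt_pi_pos : 0 < 2 / √Real.pi := by positivity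

/-- Both sides have the same derivative in `m`, by `integral_exp_neg_add_sq`, and vanish at `m = 0`
by oddness. -/
lemma integral_erf_add (m τ : ℝ) :
    ∫ g, erf (m + τ * g) ∂(gaussianReal 0 1) = erf (m / √(1 + 2 * τ ^ 2)) := by
  refine eq_of_hasDerivAt_of_eq_zero
    (f := fun m => ∫ g, erf (m + τ * g) ∂(gaussianReal 0 1))
    (g := fun m => erf (m / √(1 + 2 * τ ^ 2)))
    (f' := fun m => 2 / √Real.pi * Real.exp (-(m / √(1 + 2 * τ ^ 2)) ^ 2) *
      (√(1 + 2 * τ ^ 2))⁻¹) ?_ ?_ ?_ m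
  · intro m
    have key := (hasDerivAt_integral_of_dominated_loc_of_deriv_le (μ := gaussianReal 0 1)
      (F := fun m g => erf (m + τ * g))
      (F' := fun m g => 2 / √Real.pi * Real.exp (-(m + τ * g) ^ 2)) (x₀ := m)
      (bound := fun _ => 2 / √Real.pi) (s := Set.univ) Filter.univ_mem
      (Filter.Eventually.of_forall fun m =>
        (by fun_prop : Measurable fun g => erf (m + τ * g)).aestronglyMeasurable)
      (Integrable.of_bound
        (by fun_prop : Measurable fun g => erf (m + τ * g)).aestronglyMeasurable 1
        (ae_of_all _ fun g => abs_erf_le_one _))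
      (by fun_prop : Measurable fun g =>
        2 / √Real.pi * Real.exp (-(m + τ * g) ^ 2)).aestronglyMeasurable
      (ae_of_all _ fun g x _ => by
        rw [Real.norm_of_nonneg (by positivity)]
        exact mul_le_of_le_one_right two_div_sqrt_pi_pos.le
          (Real.exp_le_one_iff.2 (neg_nonpos.2 (sq_nonneg _))))
      (integrable_const _)
      (ae_of_all _ fun g x _ => by
        have := (hasDerivAt_erf (x + τ * g)).comp x ((hasDerivAt_id' x).add_const (τ * g))
        rw [mul_one] at this
        exact this)).2
    refine key.congr_deriv ?_
    rw [integral_const_mul, integral_exp_neg_add_sq]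
    ring
  · intro m
    simpa [Function.comp_def, div_eq_mul_inv] using (hasDerivAt_erf (m / √(1 + 2 * τ ^ 2))).comp m
      ((hasDerivAt_id m).div_const (√(1 + 2 * τ ^ 2)))
  · simp only [zero_add, zero_div, erf_zero]
    exact integral_eq_zero_of_odd fun g => by rw [mul_neg, erf_neg]

/-- Integrate by parts: the factor `g` times the combined Gaussian weight has an explicit
antiderivative, and differentiating `erf` leaves a pure Gaussian integral. -/
lemma integral_mul_exp_mul_erf (p q : ℝ) :
    ∫ g, g * Real.exp (-(p * g) ^ 2) * erf (q * g) ∂(gaussianReal 0 1) =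
      2 * q / (√Real.pi * (1 + 2 * p ^ 2) * √(1 + 2 * p ^ 2 + 2 * q ^ 2)) := by
  have hp : 0 < 1 + 2 * p ^ 2 := by positivity
  have hb : 0 < p ^ 2 + 1 / 2 := by positivity
  have hb' : 0 < p ^ 2 + q ^ 2 + 1 / 2 := by positivity
  have hv : ∀ g : ℝ, HasDerivAt
      (fun g => -(1 + 2 * p ^ 2)⁻¹ * Real.exp (-(p ^ 2 + 1 / 2) * g ^ 2))
      (g * Real.exp (-(p ^ 2 + 1 / 2) * g ^ 2)) g := fun g => by
    refine ((((hasDerivAt_pow 2 g).const_mul (-(p ^ 2 + 1 / 2))).exp).const_mul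
      (-(1 + 2 * p ^ 2)⁻¹)).congr_deriv ?_
    norm_num
    field_simp
    ring
  have hu : ∀ g : ℝ, HasDerivAt (fun g => erf (q * g))
      (2 / √Real.pi * Real.exp (-(q * g) ^ 2) * q) g := fun g => by
    simpa [Function.comp_def] using (hasDerivAt_erf (q * g)).comp g ((hasDerivAt_id g).const_mul q)
  have hmul : ∀ g : ℝ, 2 / √Real.pi * Real.exp (-(q * g) ^ 2) * q *
      (-(1 + 2 * p ^ 2)⁻¹ * Real.exp (-(p ^ 2 + 1 / 2) * g ^ 2)) =
      -(2 / √Real.pi * q * (1 + 2 * p ^ 2)⁻¹) * Real.exp (-(p ^ 2 + q ^ 2 + 1 / 2) * g ^ 2) := by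
    intro g
    have : Real.exp (-(p ^ 2 + q ^ 2 + 1 / 2) * g ^ 2) =
        Real.exp (-(q * g) ^ 2) * Real.exp (-(p ^ 2 + 1 / 2) * g ^ 2) := by
      rw [← Real.exp_add]; ring_nf
    rw [this]; ring
  have hint1 : Integrable fun g : ℝ => erf (q * g) * (g * Real.exp (-(p ^ 2 + 1 / 2) * g ^ 2)) :=
    (integrable_mul_exp_neg_mul_sq hb).bdd_mul
      (by fun_prop : Measurable fun g => erf (q * g)).aestronglyMeasurable
      (ae_of_all _ fun g => abs_erf_le_one _)
  have hint2 : Integrable fun g : ℝ => erf (q * g) *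
      (-(1 + 2 * p ^ 2)⁻¹ * Real.exp (-(p ^ 2 + 1 / 2) * g ^ 2)) :=
    ((integrable_exp_neg_mul_sq hb).const_mul _).bdd_mul
      (by fun_prop : Measurable fun g => erf (q * g)).aestronglyMeasurable
      (ae_of_all _ fun g => abs_erf_le_one _)
  have hint3 : Integrable fun g : ℝ => 2 / √Real.pi * Real.exp (-(q * g) ^ 2) * q *
      (-(1 + 2 * p ^ 2)⁻¹ * Real.exp (-(p ^ 2 + 1 / 2) * g ^ 2)) := by
    simp_rw [hmul]
    exact (integrable_exp_neg_mul_sq hb').const_mul _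
  have hparts := integral_mul_deriv_eq_deriv_mul_of_integrable (fun g _ => hu g) (fun g _ => hv g)
    hint1 hint3 hint2
  rw [integral_gaussianReal_std]
  have h1 : ∀ g : ℝ, Real.exp (-g ^ 2 / 2) * (g * Real.exp (-(p * g) ^ 2) * erf (q * g)) =
      erf (q * g) * (g * Real.exp (-(p ^ 2 + 1 / 2) * g ^ 2)) := by
    intro g
    have : Real.exp (-(p ^ 2 + 1 / 2) * g ^ 2) =
        Real.exp (-g ^ 2 / 2) * Real.exp (-(p * g) ^ 2) := by
      rw [← Real.exp_add]; ring_nf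
    rw [this]; ring
  simp_rw [h1]
  rw [hparts]
  simp_rw [hmul]
  rw [integral_const_mul, integral_gaussian]
  have : Real.pi / (p ^ 2 + q ^ 2 + 1 / 2) = (2 * Real.pi) / (1 + 2 * p ^ 2 + 2 * q ^ 2) := by
    field_simp
    ring
  rw [this, Real.sqrt_div (by positivity)]
  have h2 : √(2 * Real.pi) ≠ 0 := by positivity
  have h3 : √(1 + 2 * p ^ 2 + 2 * q ^ 2) ≠ 0 := by positivity
  have h4 : √Real.pi ≠ 0 := by positivity
  field_simp

/-- Differentiate under the integral in `p`, which produces `integral_mul_exp_mul_erf`; both sides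
vanish at `p = 0`. -/
lemma integral_erf_mul_erf (p q : ℝ) :
    ∫ g, erf (p * g) * erf (q * g) ∂(gaussianReal 0 1) =
      2 / Real.pi * Real.arctan (2 * (p * q) / √(1 + 2 * p ^ 2 + 2 * q ^ 2)) := by
  have hg : Integrable (fun g : ℝ => 2 / √Real.pi * |g|) (gaussianReal 0 1) :=
    (((memLp_id_gaussianReal 1).integrable (by simp)).abs).const_mul _
  refine eq_of_hasDerivAt_of_eq_zero
    (f := fun p => ∫ g, erf (p * g) * erf (q * g) ∂(gaussianReal 0 1))
    (g := fun p => 2 / Real.pi * Real.arctan (2 * (p * q) / √(1 + 2 * p ^ 2 + 2 * q ^ 2)))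
    (f' := fun p => 4 * q / (Real.pi * (1 + 2 * p ^ 2) * √(1 + 2 * p ^ 2 + 2 * q ^ 2))) ?_ ?_ ?_ p
  · intro p
    have key := (hasDerivAt_integral_of_dominated_loc_of_deriv_le (μ := gaussianReal 0 1)
      (F := fun p g => erf (p * g) * erf (q * g))
      (F' := fun p g => 2 / √Real.pi * (g * Real.exp (-(p * g) ^ 2) * erf (q * g))) (x₀ := p)
      (bound := fun g => 2 / √Real.pi * |g|) (s := Set.univ) Filter.univ_mem
      (Filter.Eventually.of_forall fun p =>
        (by fun_prop : Measurable fun g => erf (p * g) * erf (q * g)).aestronglyMeasurable)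
      (Integrable.of_bound
        (by fun_prop : Measurable fun g => erf (p * g) * erf (q * g)).aestronglyMeasurable 1
        (ae_of_all _ fun g => by
          rw [norm_mul]
          exact mul_le_one₀ (abs_erf_le_one _) (norm_nonneg _) (abs_erf_le_one _)))
      (by fun_prop : Measurable fun g => 2 / √Real.pi *
        (g * Real.exp (-(p * g) ^ 2) * erf (q * g))).aestronglyMeasurable
      (ae_of_all _ fun g x _ => by
        rw [norm_mul, norm_mul, norm_mul, Real.norm_of_nonneg two_div_sqrt_pi_pos.le,
          Real.norm_of_nonneg (Real.exp_pos _).le]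
        refine mul_le_mul_of_nonneg_left ?_ two_div_sqrt_pi_pos.le
        have h1 : Real.exp (-(x * g) ^ 2) ≤ 1 :=
          Real.exp_le_one_iff.2 (neg_nonpos.2 (sq_nonneg _))
        calc |g| * Real.exp (-(x * g) ^ 2) * ‖erf (q * g)‖ ≤ |g| * 1 * 1 := by
              gcongr
              exact abs_erf_le_one _
          _ = |g| := by ring)
      hg
      (ae_of_all _ fun g x _ => by
        have := ((hasDerivAt_erf (x * g)).comp x ((hasDerivAt_id x).mul_const g)).mul_const
          (erf (q * g))
        refine this.congr_deriv ?_
        ring)).2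
    refine key.congr_deriv ?_
    rw [integral_const_mul, integral_mul_exp_mul_erf]
    have h4 : √Real.pi * √Real.pi = Real.pi := Real.mul_self_sqrt Real.pi_pos.le
    have h3 : √(1 + 2 * p ^ 2 + 2 * q ^ 2) ≠ 0 := by positivity
    have h5 : √Real.pi ≠ 0 := by positivity
    conv_rhs => rw [← h4]
    field_simp
    ring
  · intro p
    have hD : 0 < 1 + 2 * p ^ 2 + 2 * q ^ 2 := by positivity
    have h3 : √(1 + 2 * p ^ 2 + 2 * q ^ 2) ≠ 0 := by positivity
    have hd : HasDerivAt (fun p => 1 + 2 * p ^ 2 + 2 * q ^ 2) (4 * p) p := by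
      refine ((((hasDerivAt_pow 2 p).const_mul 2).const_add 1).add_const (2 * q ^ 2)).congr_deriv ?_
      norm_num
      ring
    have hn : HasDerivAt (fun p => 2 * (p * q)) (2 * q) p := by
      simpa using ((hasDerivAt_id p).mul_const q).const_mul 2
    refine (((hn.div (hd.sqrt hD.ne') h3).arctan).const_mul (2 / Real.pi)).congr_deriv ?_
    rw [Pi.div_apply, div_pow, Real.sq_sqrt hD.le]
    have hsq : √(1 + 2 * p ^ 2 + 2 * q ^ 2) ^ 2 = 1 + 2 * p ^ 2 + 2 * q ^ 2 := Real.sq_sqrt hD.le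
    have hne : 1 + 2 * p ^ 2 + 2 * q ^ 2 + (2 * (p * q)) ^ 2 ≠ 0 := by positivity
    have hp : (1 + 2 * p ^ 2 : ℝ) ≠ 0 := by positivity
    -- With the root an opaque `σ` and only `σ²` known, the identity becomes one of rational
    -- functions.
    generalize √(1 + 2 * p ^ 2 + 2 * q ^ 2) = σ at *
    rw [← hsq] at hne ⊢
    field_simp
    rw [hsq]
    ring
  · simp [erf_zero]

/-! ### Correlations under the standard Gaussian vector -/

lemma hasGaussianLaw_inner_pair {d : ℕ} (w v : Vec d) :
    HasGaussianLaw (fun x : Vec d => (⟪w, x⟫, ⟪v, x⟫)) (stdGaussian (Vec d)) :=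
  (IsGaussian.hasGaussianLaw_id (μ := stdGaussian (Vec d))).map_fun
    ((innerSL ℝ w).prod (innerSL ℝ v))

lemma covariance_inner_stdGaussian {d : ℕ} (w v : Vec d) :
    cov[fun x => ⟪w, x⟫, fun x => ⟪v, x⟫; stdGaussian (Vec d)] = ⟪w, v⟫ := by
  rw [← covarianceBilin_apply_eq_cov IsGaussian.memLp_two_id, covarianceBilin_stdGaussian]
  rfl

lemma map_inner_stdGaussian {d : ℕ} (w : Vec d) :
    (stdGaussian (Vec d)).map (fun x => ⟪w, x⟫) = (gaussianReal 0 1).map (fun g => ‖w‖ * g) := by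
  have h := (hasGaussianLaw_inner_pair w w).fst.map_eq_gaussianReal
  have h1 : ∫ x, ⟪w, x⟫ ∂(stdGaussian (Vec d)) = 0 :=
    integral_strongDual_stdGaussian (innerSL ℝ w)
  have h2 : Var[fun x => ⟪w, x⟫; stdGaussian (Vec d)] = ‖w‖ ^ 2 := by
    rw [← covariance_self (by fun_prop), covariance_inner_stdGaussian, real_inner_self_eq_norm_sq]
  rw [h, h1, h2, gaussianReal_map_const_mul, mul_zero, mul_one]
  congr 1
  ext
  simp

/-- Uncorrelated jointly Gaussian variables are independent, so the joint law is a product and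
Fubini applies. -/
lemma integral_inner_orthogonal {d : ℕ} {w v : Vec d} (h : ⟪w, v⟫ = 0) {f : ℝ → ℝ → ℝ}
    (hf : Measurable (Function.uncurry f)) {C : ℝ} (hC : ∀ a b, |f a b| ≤ C) :
    ∫ x, f ⟪w, x⟫ ⟪v, x⟫ ∂(stdGaussian (Vec d)) =
      ∫ g, ∫ g', f (‖w‖ * g) (‖v‖ * g') ∂(gaussianReal 0 1) ∂(gaussianReal 0 1) := by
  have hind := (hasGaussianLaw_inner_pair w v).indepFun_of_covariance_eq_zero
    (by rw [covariance_inner_stdGaussian, h])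
  have hm := (indepFun_iff_map_prod_eq_prod_map_map (by fun_prop) (by fun_prop)).1 hind
  rw [map_inner_stdGaussian, map_inner_stdGaussian,
    Measure.map_prod_map _ _ (by fun_prop) (by fun_prop)] at hm
  have h1 := integral_map (μ := stdGaussian (Vec d)) (φ := fun x => (⟪w, x⟫, ⟪v, x⟫))
    (f := Function.uncurry f) (by fun_prop) hf.aestronglyMeasurable
  have h2 := integral_map (μ := (gaussianReal 0 1).prod (gaussianReal 0 1))
    (φ := Prod.map (fun g => ‖w‖ * g) (fun g => ‖v‖ * g))
    (f := Function.uncurry f) (by fun_prop) hf.aestronglyMeasurable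
  rw [hm, h2] at h1
  refine h1.symm.trans (integral_prod _ (Integrable.of_bound
    (hf.comp (by fun_prop)).aestronglyMeasurable C (ae_of_all _ fun p => hC _ _)))

/-- The correlation `E[erf(w·x) erf(u·x)]` for a standard Gaussian `x`. -/
def kern {d : ℕ} (w u : Vec d) : ℝ :=
  2 / Real.pi * Real.arctan (2 * ⟪w, u⟫ /
    √((1 + 2 * ‖w‖ ^ 2) * (1 + 2 * ‖u‖ ^ 2) - 4 * ⟪w, u⟫ ^ 2))

/-- Split `u = α w + v` with `v ⊥ w`. Averaging over `⟪v, x⟫` only rescales the argument of the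
second `erf` (`integral_erf_add`), which leaves the one-dimensional `integral_erf_mul_erf`. -/
lemma integral_erf_inner_mul {d : ℕ} (w u : Vec d) :
    ∫ x, erf ⟪w, x⟫ * erf ⟪u, x⟫ ∂(stdGaussian (Vec d)) = kern w u := by
  rcases eq_or_ne w 0 with rfl | hw
  · simp [erf_zero, kern]
  have hs : 0 < ‖w‖ := norm_pos_iff.2 hw
  set α := ⟪w, u⟫ / ‖w‖ ^ 2 with hα
  set v := u - α • w with hv
  have hwv : ⟪w, v⟫ = 0 := by
    rw [hv, inner_sub_right, real_inner_smul_right, real_inner_self_eq_norm_sq, hα]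
    field_simp
    ring
  have ht : ⟪w, u⟫ = α * ‖w‖ ^ 2 := by rw [hα]; field_simp
  have hu : ‖u‖ ^ 2 = α ^ 2 * ‖w‖ ^ 2 + ‖v‖ ^ 2 := by
    have : u = α • w + v := by rw [hv]; abel
    rw [this, norm_add_sq_real, real_inner_smul_left, hwv, norm_smul, mul_pow, Real.norm_eq_abs,
      sq_abs]
    ring
  have h1 : ∀ x : Vec d, erf ⟪w, x⟫ * erf ⟪u, x⟫ = erf ⟪w, x⟫ * erf (α * ⟪w, x⟫ + ⟪v, x⟫) := by
    intro x
    rw [hv, inner_sub_left, real_inner_smul_left]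
    congr 2
    ring
  simp_rw [h1]
  rw [integral_inner_orthogonal (f := fun a b => erf a * erf (α * a + b)) (C := 1) hwv
    (by simp only [Function.uncurry_def]; fun_prop)
    (fun a b => by
      rw [abs_mul]
      exact mul_le_one₀ (abs_erf_le_one _) (abs_nonneg _) (abs_erf_le_one _))]
  simp_rw [integral_const_mul, integral_erf_add]
  have hτ : 0 < 1 + 2 * ‖v‖ ^ 2 := by positivity
  have h2 : ∀ g : ℝ, α * (‖w‖ * g) / √(1 + 2 * ‖v‖ ^ 2) =
      (α * ‖w‖ / √(1 + 2 * ‖v‖ ^ 2)) * g := fun g => by ring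
  simp_rw [h2]
  rw [integral_erf_mul_erf, kern]
  congr 2
  rw [div_pow, Real.sq_sqrt hτ.le, hu, ht]
  have h3 : (1 + 2 * ‖w‖ ^ 2) * (1 + 2 * (α ^ 2 * ‖w‖ ^ 2 + ‖v‖ ^ 2)) - 4 * (α * ‖w‖ ^ 2) ^ 2 =
      (1 + 2 * ‖v‖ ^ 2) * (1 + 2 * ‖w‖ ^ 2 + 2 * ((α * ‖w‖) ^ 2 / (1 + 2 * ‖v‖ ^ 2))) := by
    field_simp
    ring
  rw [h3, Real.sqrt_mul hτ.le]
  field_simp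

lemma integral_erf_inner {d : ℕ} (u : Vec d) :
    ∫ x, erf ⟪u, x⟫ ∂(stdGaussian (Vec d)) = 0 := by
  rw [← integral_map (μ := stdGaussian (Vec d)) (φ := fun x => ⟪u, x⟫) (f := erf) (by fun_prop)
    measurable_erf.aestronglyMeasurable, map_inner_stdGaussian,
    integral_map (by fun_prop) measurable_erf.aestronglyMeasurable]
  exact integral_eq_zero_of_odd fun g => by rw [mul_neg, erf_neg]

/-! ### Closed form of the objective -/

lemma measurable_parityPredictor {d k : ℕ} (w : Fin k → Vec d) :
    Measurable (parityPredictor w) :=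
  Finset.measurable_prod _ fun l _ =>
    measurable_erf.comp (measurable_const.inner (measurable_pi_apply l))

lemma abs_parityPredictor_le_one {d k : ℕ} (w x : Fin k → Vec d) : |parityPredictor w x| ≤ 1 := by
  rw [parityPredictor, Finset.abs_prod]
  exact Finset.prod_le_one (fun _ _ => abs_nonneg _) fun _ _ => abs_erf_le_one _

lemma measurable_sumPredictorWS {d k : ℕ} [NeZero k] (w : Vec d) :
    Measurable (sumPredictorWS k w) :=
  (measurable_erf.comp (measurable_const.inner (measurable_pi_apply 0))).add
    (measurable_parityPredictor _)

lemma abs_sumPredictorWS_le {d k : ℕ} [NeZero k] (w : Vec d) (x : Fin k → Vec d) :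
    |sumPredictorWS k w x| ≤ 2 :=
  (abs_add_le _ _).trans (by
    linarith [abs_erf_le_one ⟪w, x 0⟫, abs_parityPredictor_le_one (fun _ => w) x])

instance isProbabilityMeasure_inputLaw (d k : ℕ) : IsProbabilityMeasure (inputLaw d k) := by
  unfold inputLaw
  infer_instance

lemma integral_inputLaw_prod {d k : ℕ} (f : Fin k → Vec d → ℝ) :
    ∫ x, ∏ l, f l (x l) ∂(inputLaw d k) = ∏ l, ∫ y, f l y ∂(stdGaussian (Vec d)) :=
  integral_fintype_prod_eq_prod f

lemma prod_ite_zero_erf {d k : ℕ} [NeZero k] (u : Vec d) (x : Fin k → Vec d) :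
    ∏ l, (if l = 0 then erf ⟪u, x l⟫ else 1) = erf ⟪u, x 0⟫ := by
  rw [Finset.prod_ite_eq' Finset.univ (0 : Fin k) (fun l => erf ⟪u, x l⟫)]
  simp

lemma integral_parity_mul_parity {d k : ℕ} (w u : Vec d) :
    ∫ x, parityPredictor (fun _ : Fin k => w) x * parityPredictor (fun _ => u) x ∂(inputLaw d k) =
      kern w u ^ k := by
  simp_rw [parityPredictor, ← Finset.prod_mul_distrib]
  rw [integral_inputLaw_prod fun _ y => erf ⟪w, y⟫ * erf ⟪u, y⟫]
  simp [integral_erf_inner_mul]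

lemma integral_erf_mul_erf_first {d k : ℕ} [NeZero k] (w u : Vec d) :
    ∫ x, erf ⟪w, x 0⟫ * erf ⟪u, x 0⟫ ∂(inputLaw d k) = kern w u := by
  have h := integral_comp_eval (μ := fun _ : Fin k => stdGaussian (Vec d)) (i := (0 : Fin k))
    (f := fun y => erf ⟪w, y⟫ * erf ⟪u, y⟫)
    (by fun_prop : Measurable fun y : Vec d => erf ⟪w, y⟫ * erf ⟪u, y⟫).aestronglyMeasurable
  rw [integral_erf_inner_mul] at h
  exact h

/-- Each of the `k - 1` patches other than the first contributes `E[erf(u·x)] = 0`. The convention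
`0 ^ 0 = 1` covers `k = 1`, where no such patch exists. -/
lemma integral_erf_mul_parity {d k : ℕ} [NeZero k] (w u : Vec d) :
    ∫ x, erf ⟪w, x 0⟫ * parityPredictor (fun _ : Fin k => u) x ∂(inputLaw d k) =
      0 ^ (k - 1) * kern w u := by
  have h1 : ∀ x : Fin k → Vec d, erf ⟪w, x 0⟫ * parityPredictor (fun _ => u) x =
      ∏ l, (fun (l : Fin k) (y : Vec d) =>
        (if l = 0 then erf ⟪w, y⟫ else 1) * erf ⟪u, y⟫) l (x l) := fun x => by
    simp only
    rw [Finset.prod_mul_distrib, prod_ite_zero_erf, parityPredictor]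
  rw [integral_congr_ae (ae_of_all _ h1), integral_inputLaw_prod fun (l : Fin k) (y : Vec d) =>
    (if l = 0 then erf ⟪w, y⟫ else 1) * erf ⟪u, y⟫, ← Finset.mul_prod_erase _ _ (Finset.mem_univ 0), mul_comm]
  congr 1
  · rw [Finset.prod_congr rfl (g := fun _ => (0 : ℝ)), Finset.prod_const,
      Finset.card_erase_of_mem (Finset.mem_univ _), Finset.card_univ, Fintype.card_fin]
    intro l hl
    simp [Finset.ne_of_mem_erase hl, integral_erf_inner]
  · simp [integral_erf_inner_mul]

/-- The coefficient of the first-order term of the correlation of two sum predictors: it is `1`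
unless `k = 1`, when the two summands of the predictor coincide. -/
def linCoeff (k : ℕ) : ℝ := 1 + 2 * 0 ^ (k - 1)

lemma integrable_inputLaw_of_abs_le {d k : ℕ} {f : (Fin k → Vec d) → ℝ} (hf : Measurable f)
    {C : ℝ} (hC : ∀ x, |f x| ≤ C) : Integrable f (inputLaw d k) :=
  Integrable.of_bound hf.aestronglyMeasurable C (ae_of_all _ hC)

lemma abs_mul_le_sq {a b C : ℝ} (ha : |a| ≤ C) (hb : |b| ≤ C) : |a * b| ≤ C * C := by
  rw [abs_mul]
  exact mul_le_mul ha hb (abs_nonneg _) ((abs_nonneg _).trans ha)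

lemma integral_sumPredictorWS_mul {d k : ℕ} [NeZero k] (w u : Vec d) :
    ∫ x, sumPredictorWS k w x * sumPredictorWS k u x ∂(inputLaw d k) =
      linCoeff k * kern w u + kern w u ^ k := by
  have me : ∀ w : Vec d, Measurable fun x : Fin k → Vec d => erf ⟪w, x 0⟫ := fun w =>
    measurable_erf.comp (measurable_const.inner (measurable_pi_apply 0))
  have mp : ∀ w : Vec d, Measurable fun x : Fin k → Vec d => parityPredictor (fun _ => w) x :=
    fun w => measurable_parityPredictor _
  have be : ∀ (w : Vec d) (x : Fin k → Vec d), |erf ⟪w, x 0⟫| ≤ 1 := fun _ _ => abs_erf_le_one _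
  have bp : ∀ (w : Vec d) (x : Fin k → Vec d), |parityPredictor (fun _ => w) x| ≤ 1 :=
    fun _ _ => abs_parityPredictor_le_one _ _
  have i1 : Integrable (fun x => erf ⟪w, x 0⟫ * erf ⟪u, x 0⟫) (inputLaw d k) :=
    integrable_inputLaw_of_abs_le ((me w).mul (me u))
    fun x => abs_mul_le_sq (be w x) (be u x)
  have i2 : Integrable (fun x => erf ⟪w, x 0⟫ * parityPredictor (fun _ => u) x) (inputLaw d k) :=
    integrable_inputLaw_of_abs_le ((me w).mul (mp u))
    fun x => abs_mul_le_sq (be w x) (bp u x)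
  have i3 : Integrable (fun x => erf ⟪u, x 0⟫ * parityPredictor (fun _ => w) x) (inputLaw d k) :=
    integrable_inputLaw_of_abs_le ((me u).mul (mp w))
    fun x => abs_mul_le_sq (be u x) (bp w x)
  have i4 : Integrable (fun x => parityPredictor (fun _ => w) x * parityPredictor (fun _ => u) x)
      (inputLaw d k) :=
    integrable_inputLaw_of_abs_le ((mp w).mul (mp u))
    fun x => abs_mul_le_sq (bp w x) (bp u x)
  have h : ∀ x : Fin k → Vec d, sumPredictorWS k w x * sumPredictorWS k u x =
      ((erf ⟪w, x 0⟫ * erf ⟪u, x 0⟫ + erf ⟪w, x 0⟫ * parityPredictor (fun _ => u) x) +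
        erf ⟪u, x 0⟫ * parityPredictor (fun _ => w) x) +
        parityPredictor (fun _ => w) x * parityPredictor (fun _ => u) x := fun x => by
    simp only [sumPredictorWS, sumPredictor]
    ring
  have hsymm : kern u w = kern w u := by
    rw [kern, kern, real_inner_comm, mul_comm (1 + 2 * ‖u‖ ^ 2)]
  simp_rw [h]
  rw [integral_add ((i1.fun_add i2).fun_add i3) i4, integral_add (i1.fun_add i2) i3, integral_add i1 i2,
    integral_erf_mul_erf_first, integral_erf_mul_parity, integral_erf_mul_parity,
    integral_parity_mul_parity, hsymm, linCoeff]
  ring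

lemma objective_eq {d k : ℕ} [NeZero k] (u w : Vec d) :
    objective k u w = 1 / 2 * (linCoeff k * kern w w + kern w w ^ k) +
      1 / 2 * (linCoeff k * kern u u + kern u u ^ k) -
      (linCoeff k * kern w u + kern w u ^ k) := by
  have hi : ∀ w u : Vec d, Integrable (fun x => sumPredictorWS k w x * sumPredictorWS k u x)
      (inputLaw d k) := fun w u =>
    integrable_inputLaw_of_abs_le ((measurable_sumPredictorWS w).mul (measurable_sumPredictorWS u))
      fun x => abs_mul_le_sq (abs_sumPredictorWS_le w x) (abs_sumPredictorWS_le u x)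
  have h : ∀ x, 1 / 2 * (sumPredictorWS k w x - sumPredictorWS k u x) ^ 2 =
      (1 / 2 * (sumPredictorWS k w x * sumPredictorWS k w x) +
        1 / 2 * (sumPredictorWS k u x * sumPredictorWS k u x)) -
        sumPredictorWS k w x * sumPredictorWS k u x := fun x => by ring
  rw [objective]
  simp_rw [h]
  rw [integral_sub (((hi w w).const_mul _).fun_add ((hi u u).const_mul _)) (hi w u),
    integral_add ((hi w w).const_mul _) ((hi u u).const_mul _), integral_const_mul,
    integral_const_mul, integral_sumPredictorWS_mul, integral_sumPredictorWS_mul,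
    integral_sumPredictorWS_mul]

/-! ### The gradient of the objective -/

/-- The discriminant `(1 + 2‖w‖²)(1 + 2‖u‖²) - 4⟪w, u⟫²`. -/
def disc {d : ℕ} (w u : Vec d) : ℝ := (1 + 2 * ‖w‖ ^ 2) * (1 + 2 * ‖u‖ ^ 2) - 4 * ⟪w, u⟫ ^ 2

/-- The Gram determinant `‖w‖²‖u‖² - ⟪w, u⟫²`. -/
def gram {d : ℕ} (w u : Vec d) : ℝ := ‖w‖ ^ 2 * ‖u‖ ^ 2 - ⟪w, u⟫ ^ 2

lemma gram_nonneg {d : ℕ} (w u : Vec d) : 0 ≤ gram w u := by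
  have h := abs_real_inner_le_norm w u
  have h2 : ⟪w, u⟫ ^ 2 ≤ (‖w‖ * ‖u‖) ^ 2 := sq_le_sq' (by linarith [neg_abs_le ⟪w, u⟫])
    ((le_abs_self _).trans h)
  rw [gram]
  nlinarith

lemma disc_eq {d : ℕ} (w u : Vec d) :
    disc w u = 1 + 2 * ‖w‖ ^ 2 + 2 * ‖u‖ ^ 2 + 4 * gram w u := by
  rw [disc, gram]
  ring

lemma one_le_disc {d : ℕ} (w u : Vec d) : 1 ≤ disc w u := by
  rw [disc_eq]
  nlinarith [gram_nonneg w u, sq_nonneg ‖w‖, sq_nonneg ‖u‖]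

lemma disc_pos {d : ℕ} (w u : Vec d) : 0 < disc w u := one_pos.trans_le (one_le_disc w u)

lemma disc_self {d : ℕ} (w : Vec d) : disc w w = 1 + 4 * ‖w‖ ^ 2 := by
  rw [disc, real_inner_self_eq_norm_sq]
  ring

lemma kern_eq {d : ℕ} (w u : Vec d) :
    kern w u = 2 / Real.pi * Real.arctan (2 * ⟪w, u⟫ / √(disc w u)) := rfl

lemma hasDerivAt_inv_sqrt {y : ℝ} (hy : 0 < y) :
    HasDerivAt (fun y => (√y)⁻¹) (-(1 / 2) * (√y)⁻¹ / y) y := by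
  have hs : √y ≠ 0 := (Real.sqrt_pos.2 hy).ne'
  refine ((Real.hasDerivAt_sqrt hy.ne').inv hs).congr_deriv ?_
  rw [Real.sq_sqrt hy.le]
  field_simp

lemma hasFDerivAt_norm_sq {d : ℕ} (w : Vec d) :
    HasFDerivAt (fun w : Vec d => ‖w‖ ^ 2) ((2 : ℝ) • innerSL ℝ w) w :=
  (hasStrictFDerivAt_norm_sq w).hasFDerivAt.congr_fderiv (ofNat_smul_eq_nsmul ℝ 2 _).symm

lemma hasFDerivAt_inner_left {d : ℕ} (u w : Vec d) :
    HasFDerivAt (fun w : Vec d => ⟪w, u⟫) (innerSL ℝ u) w := by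
  have h : (fun w : Vec d => ⟪w, u⟫) = innerSL ℝ u := by
    funext w
    rw [innerSL_apply_apply, real_inner_comm]
  rw [h]
  exact (innerSL ℝ u).hasFDerivAt

/-- The scalar identity behind the chain rule for `kern`; the derivative of `arctan` simplifies
because `1 + (2t/σ)² = ab/σ²`. -/
lemma gradient_kern_aux {a b t σ : ℝ} (ha : 0 < a) (hb : 0 < b) (hσ : 0 < σ)
    (h : σ ^ 2 = a * b - 4 * t ^ 2) (x y : ℝ) :
    2 / Real.pi * ((1 + (2 * t * σ⁻¹) ^ 2)⁻¹ *
        (2 * t * (-(2⁻¹ * σ⁻¹) / σ ^ 2 * (4 * b * x - 8 * t * y)))) +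
      2 / Real.pi * ((1 + (2 * t * σ⁻¹) ^ 2)⁻¹ * (σ⁻¹ * (2 * y))) =
    4 / Real.pi / σ * (y - 2 * t / a * x) := by
  have h1 : (1 + (2 * t * σ⁻¹) ^ 2)⁻¹ = σ ^ 2 / (a * b) := by
    rw [inv_eq_one_div, div_eq_div_iff (by positivity) (by positivity)]
    field_simp
    linarith
  rw [h1]
  field_simp
  linear_combination (4 * y) * h

lemma hasGradientAt_kern_left {d : ℕ} (u w : Vec d) :
    HasGradientAt (fun w => kern w u)
      ((4 / Real.pi / √(disc w u)) • (u - (2 * ⟪w, u⟫ / (1 + 2 * ‖w‖ ^ 2)) • w)) w := by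
  have hD := disc_pos w u
  have hσ : 0 < √(disc w u) := Real.sqrt_pos.2 hD
  have ht := hasFDerivAt_inner_left u w
  have hd : HasFDerivAt (fun w => disc w u)
      ((4 * (1 + 2 * ‖u‖ ^ 2)) • innerSL ℝ w - (8 * ⟪w, u⟫) • innerSL ℝ u) w := by
    refine (((((hasFDerivAt_norm_sq w).const_mul 2).const_add 1).mul_const (1 + 2 * ‖u‖ ^ 2)).sub
      ((ht.pow 2).const_mul 4)).congr_fderiv ?_
    ext v
    simp
    ring
  have hq := (((ht.const_mul 2).mul
    ((hasDerivAt_inv_sqrt hD).comp_hasFDerivAt w hd)).arctan).const_mul (2 / Real.pi)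
  rw [hasGradientAt_iff_hasFDerivAt]
  refine (hq.congr_fderiv ?_)
  ext v
  have h2 : √(disc w u) ^ 2 = (1 + 2 * ‖w‖ ^ 2) * (1 + 2 * ‖u‖ ^ 2) - 4 * ⟪w, u⟫ ^ 2 :=
    Real.sq_sqrt hD.le
  have key := gradient_kern_aux (a := 1 + 2 * ‖w‖ ^ 2) (b := 1 + 2 * ‖u‖ ^ 2) (t := ⟪w, u⟫)
    (by positivity) (by positivity) hσ h2 ⟪w, v⟫ ⟪u, v⟫
  rw [Real.sq_sqrt hD.le] at key
  simpa [inner_sub_left, real_inner_smul_left] using key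

/-- The self-correlation is radial, so it is differentiated through `s = ‖w‖²`. -/
lemma hasGradientAt_kern_self {d : ℕ} (w : Vec d) :
    HasGradientAt (fun w => kern w w)
      ((8 / Real.pi / ((1 + 2 * ‖w‖ ^ 2) * √(disc w w))) • w) w := by
  have hs : 0 < 1 + 4 * ‖w‖ ^ 2 := by positivity
  have hσ : 0 < √(1 + 4 * ‖w‖ ^ 2) := Real.sqrt_pos.2 hs
  have hsq := Real.sq_sqrt hs.le
  have h0 : (fun w : Vec d => kern w w) =
      (fun s : ℝ => 2 / Real.pi * Real.arctan (2 * s * (√(1 + 4 * s))⁻¹)) ∘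
        fun w : Vec d => ‖w‖ ^ 2 := by
    funext w
    simp only [kern_eq, disc_self, real_inner_self_eq_norm_sq, Function.comp_apply]
    rw [div_eq_mul_inv (2 * ‖w‖ ^ 2)]
  have h1 : HasDerivAt (fun s : ℝ => 1 + 4 * s) 4 (‖w‖ ^ 2) := by
    simpa using ((hasDerivAt_id' (‖w‖ ^ 2)).const_mul 4).const_add 1
  have h2 : HasDerivAt (fun s : ℝ => 2 * s) 2 (‖w‖ ^ 2) := by
    simpa using (hasDerivAt_id' (‖w‖ ^ 2)).const_mul 2
  have h3 := ((h2.mul ((hasDerivAt_inv_sqrt hs).comp (‖w‖ ^ 2) h1)).arctan).const_mul (2 / Real.pi)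
  have h4 := h3.comp_hasFDerivAt w (hasFDerivAt_norm_sq w)
  rw [hasGradientAt_iff_hasFDerivAt, h0, disc_self]
  refine h4.congr_fderiv ?_
  ext v
  have h5 : (1 + (2 * ‖w‖ ^ 2 * (√(1 + 4 * ‖w‖ ^ 2))⁻¹) ^ 2)⁻¹ =
      (1 + 4 * ‖w‖ ^ 2) / (1 + 2 * ‖w‖ ^ 2) ^ 2 := by
    rw [mul_pow, inv_pow, hsq, inv_eq_one_div, div_eq_div_iff (by positivity) (by positivity)]
    field_simp
    ring
  simp only [smul_apply, innerSL_apply_apply, InnerProductSpace.toDual_apply_apply,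
    real_inner_smul_left, smul_eq_mul, Pi.mul_apply, Function.comp_apply, one_div]
  rw [h5]
  field_simp
  ring

/-- The derivative of `y ↦ linCoeff k * y + y ^ k`. -/
def linkDeriv (k : ℕ) (y : ℝ) : ℝ := linCoeff k + k * y ^ (k - 1)

lemma hasDerivAt_link (k : ℕ) (y : ℝ) :
    HasDerivAt (fun y => linCoeff k * y + y ^ k) (linkDeriv k y) y := by
  simpa [linkDeriv] using ((hasDerivAt_id' y).const_mul (linCoeff k)).fun_add (hasDerivAt_pow k y)

/-- The coefficient of `-u` in the scaled gradient. -/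
def pullCoeff {d : ℕ} (k : ℕ) (u w : Vec d) : ℝ := linkDeriv k (kern w u) / √(disc w u)

/-- The coefficient of `w` in the scaled gradient which comes from the self-correlation. -/
def selfCoeff {d : ℕ} (k : ℕ) (w : Vec d) : ℝ :=
  linkDeriv k (kern w w) / ((1 + 2 * ‖w‖ ^ 2) * √(disc w w))

/-- The coefficient of `w` in the scaled gradient. -/
def decayCoeff {d : ℕ} (k : ℕ) (u w : Vec d) : ℝ :=
  selfCoeff k w + 2 * ⟪w, u⟫ / (1 + 2 * ‖w‖ ^ 2) * pullCoeff k u w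

/-- The gradient of the objective, multiplied by `π / 4`. -/
def scaledGrad {d : ℕ} (k : ℕ) (u w : Vec d) : Vec d :=
  decayCoeff k u w • w - pullCoeff k u w • u

lemma gradient_objective {d k : ℕ} [NeZero k] (u w : Vec d) :
    ∇ (objective k u) w = (4 / Real.pi) • scaledGrad k u w := by
  have h1 := (hasDerivAt_link k (kern w w)).comp_hasFDerivAt (f := fun w => kern w w) w
    (hasGradientAt_iff_hasFDerivAt.1 (hasGradientAt_kern_self w))
  have h2 := (hasDerivAt_link k (kern w u)).comp_hasFDerivAt (f := fun w => kern w u) w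
    (hasGradientAt_iff_hasFDerivAt.1 (hasGradientAt_kern_left u w))
  have h3 := ((h1.const_mul (1 / 2)).add_const
    (1 / 2 * (linCoeff k * kern u u + kern u u ^ k))).sub h2
  have h4 : HasGradientAt (objective k u) ((4 / Real.pi) • scaledGrad k u w) w := by
    rw [hasGradientAt_iff_hasFDerivAt, show objective k u = _ from funext (objective_eq u)]
    refine h3.congr_fderiv ?_
    ext v
    simp [scaledGrad, decayCoeff, selfCoeff, pullCoeff]
    ring
  exact h4.gradient

/-! ### Bounds on the link derivative and algebra of the Gram determinant -/

lemma arctan_sub_arctan_le {x y : ℝ} (h : y ≤ x) : Real.arctan x - Real.arctan y ≤ x - y := by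
  simpa using image_sub_le_mul_sub_of_deriv_le Real.differentiable_arctan (C := 1) (fun z => by
    rw [Real.deriv_arctan]
    exact div_le_one_of_le₀ (by nlinarith [sq_nonneg z]) (by positivity)) h

lemma pow_sub_pow_le_mul {a b δ : ℝ} (ha : 0 ≤ a) (ha1 : a ≤ 1) (hb : 0 ≤ b) (hb1 : b ≤ 1)
    (hδ : 0 ≤ δ) (h : a - b ≤ δ) (n : ℕ) : a ^ n - b ^ n ≤ n * δ := by
  induction n with
  | zero => simp
  | succ n ih =>
    have h1 : a * (a ^ n - b ^ n) ≤ n * δ :=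
      (mul_le_mul_of_nonneg_left ih ha).trans (mul_le_of_le_one_left (by positivity) ha1)
    have h2 : (a - b) * b ^ n ≤ δ :=
      (mul_le_mul_of_nonneg_right h (pow_nonneg hb n)).trans
        (mul_le_of_le_one_right hδ (pow_le_one₀ hb hb1))
    push_cast
    linarith [show a ^ (n + 1) - b ^ (n + 1) = a * (a ^ n - b ^ n) + (a - b) * b ^ n by ring]

lemma one_le_linCoeff (k : ℕ) : 1 ≤ linCoeff k := by
  have : (0 : ℝ) ≤ 0 ^ (k - 1) := by positivity
  rw [linCoeff]
  linarith

lemma linCoeff_le (k : ℕ) : linCoeff k ≤ 3 := by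
  have : (0 : ℝ) ^ (k - 1) ≤ 1 := pow_le_one₀ le_rfl zero_le_one
  rw [linCoeff]
  linarith

/-- This is where the first-order summand of the predictor helps: `k * y ^ (k - 1)` alone has no
useful lower bound for small `y`. -/
lemma one_le_linkDeriv {k : ℕ} {y : ℝ} (hy : 0 ≤ y) : 1 ≤ linkDeriv k y := by
  have := one_le_linCoeff k
  have : 0 ≤ k * y ^ (k - 1) := by positivity
  rw [linkDeriv]
  linarith

lemma linkDeriv_le {k : ℕ} (hk : 1 ≤ (k : ℝ)) {y : ℝ} (hy : 0 ≤ y) (hy1 : y ≤ 1) :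
    linkDeriv k y ≤ 4 * k := by
  have h1 := linCoeff_le k
  have h2 : k * y ^ (k - 1) ≤ (k : ℝ) :=
    mul_le_of_le_one_right (by positivity) (pow_le_one₀ hy hy1)
  rw [linkDeriv]
  linarith

lemma linkDeriv_sub_le {k : ℕ} {a b δ : ℝ} (ha : 0 ≤ a) (ha1 : a ≤ 1) (hb : 0 ≤ b) (hb1 : b ≤ 1)
    (hδ : 0 ≤ δ) (h : a - b ≤ δ) : linkDeriv k a - linkDeriv k b ≤ (k : ℝ) ^ 2 * δ := by
  have h1 := pow_sub_pow_le_mul ha ha1 hb hb1 hδ h (k - 1)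
  have h2 : ((k - 1 : ℕ) : ℝ) * δ ≤ k * δ :=
    mul_le_mul_of_nonneg_right (by exact_mod_cast Nat.sub_le k 1) hδ
  have h3 : k * (a ^ (k - 1) - b ^ (k - 1)) ≤ (k : ℝ) * (k * δ) :=
    mul_le_mul_of_nonneg_left (h1.trans h2) (by positivity)
  rw [linkDeriv, linkDeriv]
  linarith [show (k : ℝ) ^ 2 * δ = k * (k * δ) by ring]

lemma kern_nonneg {d : ℕ} {w u : Vec d} (h : 0 ≤ ⟪w, u⟫) : 0 ≤ kern w u := by
  rw [kern_eq]
  have : 0 ≤ Real.arctan (2 * ⟪w, u⟫ / √(disc w u)) := Real.arctan_nonneg.2 (by positivity)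
  positivity

lemma kern_le_one {d : ℕ} (w u : Vec d) : kern w u ≤ 1 := by
  rw [kern_eq, div_mul_eq_mul_div, div_le_one Real.pi_pos]
  linarith [Real.arctan_lt_pi_div_two (2 * ⟪w, u⟫ / √(disc w u))]

lemma kern_self_nonneg {d : ℕ} (w : Vec d) : 0 ≤ kern w w := kern_nonneg real_inner_self_nonneg

lemma norm_sub_sq_mul_norm_sq {d : ℕ} (w u : Vec d) :
    ‖w‖ ^ 2 * ‖w - u‖ ^ 2 = gram w u + (⟪w, u⟫ - ‖w‖ ^ 2) ^ 2 := by
  rw [norm_sub_sq_real, gram]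
  ring

lemma disc_eq_add {d : ℕ} (w u : Vec d) :
    disc w u = 1 + 4 * ‖w‖ ^ 2 + 4 * (⟪w, u⟫ - ‖w‖ ^ 2) + 2 * ‖w - u‖ ^ 2 + 4 * gram w u := by
  rw [disc_eq, norm_sub_sq_real]
  ring

/-- Read `s = ‖w‖²`, `q = ⟪w, u⟫ - ‖w‖²`, `N = ‖w - u‖²`, `Δ = gram w u`. Modulo `s N = Δ + q²`, the
gap between the sides is a polynomial with nonnegative coefficients. -/
lemma sq_margin {s q N Δ : ℝ} (hs : 0 ≤ s) (hq : 0 ≤ q) (hN : 0 ≤ N) (hΔ : 0 ≤ Δ)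
    (h : s * N = Δ + q ^ 2) :
    q ^ 2 * (1 + 4 * s + 4 * q + 2 * N + 4 * Δ) + N * (N + q) ≤
      (q + N + 2 * Δ) ^ 2 * (1 + 4 * s) := by
  have h1 : (q + N + 2 * Δ) ^ 2 * (1 + 4 * s) -
      (q ^ 2 * (1 + 4 * s + 4 * q + 2 * N + 4 * Δ) + N * (N + q)) =
      q * N + 12 * q * Δ + 8 * N * Δ + 20 * Δ ^ 2 + 4 * q ^ 3 + 16 * s * q * Δ + 2 * N * q ^ 2 +
        12 * Δ * q ^ 2 + 16 * s * Δ ^ 2 := by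
    linear_combination (8 * q + 4 * N + 16 * Δ) * h
  have : 0 ≤ q * N + 12 * q * Δ + 8 * N * Δ + 20 * Δ ^ 2 + 4 * q ^ 3 + 16 * s * q * Δ +
      2 * N * q ^ 2 + 12 * Δ * q ^ 2 + 16 * s * Δ ^ 2 := by positivity
  linarith

/-- With `X = (q + N + 2Δ) S` and `Y = q σ`, `sq_margin` bounds `X² - Y²` below by `N (N + q)`.
Dividing by `X + Y ≤ 2 (q + N)(1 + 2s) S` cancels the factor `N + q`. -/
lemma div_sub_div_margin {s q N Δ S σ : ℝ} (hs : 0 ≤ s) (hq : 0 ≤ q) (hN : 0 ≤ N) (hΔ : 0 ≤ Δ)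
    (h : s * N = Δ + q ^ 2) (hS : 0 < S) (hS2 : S ^ 2 = 1 + 4 * s) (hσ : 0 < σ)
    (hσ2 : σ ^ 2 = 1 + 4 * s + 4 * q + 2 * N + 4 * Δ) :
    N / (2 * σ * S ^ 2 * (1 + 2 * s)) ≤ (q + N + 2 * Δ) / σ - q / S := by
  have h1 := sq_margin hs hq hN hΔ h
  rw [← hσ2, ← hS2, ← mul_pow, ← mul_pow] at h1
  set X := (q + N + 2 * Δ) * S with hX
  set Y := q * σ with hY
  have hX0 : 0 ≤ X := by positivity
  have hY0 : 0 ≤ Y := by positivity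
  have hYX : Y ≤ X := by
    refine le_of_sq_le_sq ?_ hX0
    nlinarith [mul_nonneg hN hq, mul_nonneg hN hN]
  have hΔ' : Δ ≤ s * N := by rw [h]; nlinarith
  have h2 : X ≤ (q + N) * (1 + 2 * s) * S := by
    rw [hX]
    refine mul_le_mul_of_nonneg_right ?_ hS.le
    nlinarith [mul_nonneg hs hq]
  have h3 : N ≤ (X - Y) * (2 * (1 + 2 * s) * S) := by
    rcases eq_or_lt_of_le hN with h0 | h0
    · rw [← h0]
      exact mul_nonneg (by linarith) (by positivity)
    · have h4 : (X - Y) * (X + Y) ≤ (X - Y) * (2 * ((q + N) * (1 + 2 * s) * S)) :=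
        mul_le_mul_of_nonneg_left (by linarith) (by linarith)
      have h5 : (N + q) * N ≤ (N + q) * ((X - Y) * (2 * (1 + 2 * s) * S)) := by nlinarith
      exact le_of_mul_le_mul_left h5 (by linarith)
  have h6 : (q + N + 2 * Δ) / σ - q / S = (X - Y) / (σ * S) := by
    rw [hX, hY]
    field_simp
  rw [h6, div_le_div_iff₀ (by positivity) (by positivity)]
  calc N * (σ * S) ≤ (X - Y) * (2 * (1 + 2 * s) * S) * (σ * S) :=
        mul_le_mul_of_nonneg_right h3 (by positivity)
    _ = (X - Y) * (2 * σ * S ^ 2 * (1 + 2 * s)) := by ring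

/-- The difference of squares `(sσ)² - (tS)²` equals `2s(1 + 2s)Δ` minus a term that is nonnegative
because `s ≤ t`. Thus, with `s = ‖w‖²` and `t = ⟪w, u⟫`, the self-correlation can exceed the
cross-correlation only through the Gram determinant. -/
lemma div_sub_div_le_gram {s t R Δ S σ : ℝ} (hs : 0 < s) (hst : s ≤ t)
    (hΔ : 0 ≤ Δ) (h : s * R = Δ + t ^ 2) (hS : 1 ≤ S) (hS2 : S ^ 2 = 1 + 4 * s) (hσ : 1 ≤ σ)
    (hσ2 : σ ^ 2 = 1 + 2 * s + 2 * R + 4 * Δ) :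
    s / S - t / σ ≤ 2 * (1 + 2 * s) * Δ := by
  have h1 : (s * σ) ^ 2 - (t * S) ^ 2 ≤ 2 * s * (1 + 2 * s) * Δ := by
    rw [mul_pow, mul_pow, hσ2, hS2]
    have : s ^ 2 * (1 + 2 * s + 2 * R + 4 * Δ) - t ^ 2 * (1 + 4 * s) =
        2 * s * (1 + 2 * s) * Δ - (1 + 2 * s) * (t ^ 2 - s ^ 2) := by
      linear_combination (2 * s) * h
    have h2 : 0 ≤ (1 + 2 * s) * (t ^ 2 - s ^ 2) := mul_nonneg (by linarith) (by nlinarith)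
    linarith
  have h6 : s / S - t / σ = (s * σ - t * S) / (S * σ) := by
    field_simp
  have h0 : 0 ≤ 2 * (1 + 2 * s) * Δ := by positivity
  rw [h6, div_le_iff₀ (by positivity)]
  rcases le_total (s * σ) (t * S) with h2 | h2
  · have : 0 ≤ 2 * (1 + 2 * s) * Δ * (S * σ) := by positivity
    linarith
  · have h3 : s * ((s * σ - t * S) * σ) ≤ s * (2 * (1 + 2 * s) * Δ) := by
      have : 0 ≤ (s * σ - t * S) * (t * S) :=
        mul_nonneg (by linarith) (mul_nonneg (by linarith) (by linarith))
      nlinarith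
    have h4 := le_of_mul_le_mul_left h3 hs
    have h5 : s * σ - t * S ≤ (s * σ - t * S) * σ := le_mul_of_one_le_right (by linarith) hσ
    have h7 : 1 ≤ S * σ := one_le_mul_of_one_le_of_one_le hS hσ
    nlinarith

lemma inner_scaledGrad_eq {d k : ℕ} (u w : Vec d) :
    ⟪scaledGrad k u w, w - u⟫ = (linkDeriv k (kern w u) * ((‖u‖ ^ 2 - ⟪w, u⟫ + 2 * gram w u) /
      √(disc w u)) - linkDeriv k (kern w w) * ((⟪w, u⟫ - ‖w‖ ^ 2) / √(disc w w))) /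
      (1 + 2 * ‖w‖ ^ 2) := by
  have h1 : 0 < √(disc w u) := Real.sqrt_pos.2 (disc_pos w u)
  have h2 : 0 < √(disc w w) := Real.sqrt_pos.2 (disc_pos w w)
  have h3 : 0 < 1 + 2 * ‖w‖ ^ 2 := by positivity
  simp only [scaledGrad, inner_sub_left, inner_sub_right, real_inner_smul_left,
    real_inner_self_eq_norm_sq, decayCoeff, selfCoeff, pullCoeff, gram, real_inner_comm w u]
  field_simp
  ring

lemma one_le_sqrt_disc {d : ℕ} (w u : Vec d) : 1 ≤ √(disc w u) :=
  Real.one_le_sqrt.2 (one_le_disc w u)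

/-! ### Gradient estimates on the ball of radius `‖u‖` -/

section Bounds

variable {d k : ℕ} {u w : Vec d}

lemma one_add_two_norm_sq_le (hk : 1 ≤ (k : ℝ)) (hR : ‖u‖ ^ 2 ≤ 2 * (k : ℝ) ^ 2)
    (hsR : ‖w‖ ^ 2 ≤ ‖u‖ ^ 2) : 1 + 2 * ‖w‖ ^ 2 ≤ 5 * (k : ℝ) ^ 2 := by
  nlinarith

lemma sqrt_disc_le (hk : 1 ≤ (k : ℝ)) (hR : ‖u‖ ^ 2 ≤ 2 * (k : ℝ) ^ 2)
    (hsR : ‖w‖ ^ 2 ≤ ‖u‖ ^ 2) : √(disc w u) ≤ 5 * (k : ℝ) ^ 2 := by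
  refine Real.sqrt_le_iff.2 ⟨by positivity, ?_⟩
  have h1 := one_add_two_norm_sq_le hk hR hsR
  have h2 := one_add_two_norm_sq_le hk hR le_rfl
  have h3 := mul_le_mul h1 h2 (by positivity) (by positivity)
  rw [disc]
  nlinarith [sq_nonneg ⟪w, u⟫]

lemma disc_self_le (hk : 1 ≤ (k : ℝ)) (hR : ‖u‖ ^ 2 ≤ 2 * (k : ℝ) ^ 2)
    (hsR : ‖w‖ ^ 2 ≤ ‖u‖ ^ 2) : disc w w ≤ 9 * (k : ℝ) ^ 2 := by
  rw [disc_self]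
  nlinarith

lemma sqrt_disc_self_le (hk : 1 ≤ (k : ℝ)) (hR : ‖u‖ ^ 2 ≤ 2 * (k : ℝ) ^ 2)
    (hsR : ‖w‖ ^ 2 ≤ ‖u‖ ^ 2) : √(disc w w) ≤ 9 * (k : ℝ) ^ 2 := by
  have h1 := one_le_sqrt_disc w w
  have h2 := Real.sq_sqrt (disc_pos w w).le
  nlinarith [disc_self_le hk hR hsR]

lemma inner_le_norm_sq (hsR : ‖w‖ ^ 2 ≤ ‖u‖ ^ 2) : ⟪w, u⟫ ≤ ‖u‖ ^ 2 := by
  have h := real_inner_le_norm w u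
  nlinarith [sq_nonneg (‖w‖ - ‖u‖)]

lemma selfCoeff_ge (hk : 1 ≤ (k : ℝ)) (hR : ‖u‖ ^ 2 ≤ 2 * (k : ℝ) ^ 2)
    (hsR : ‖w‖ ^ 2 ≤ ‖u‖ ^ 2) : 1 / (45 * (k : ℝ) ^ 4) ≤ selfCoeff k w := by
  have h0 := one_le_sqrt_disc w w
  refine div_le_div₀ (zero_le_one.trans (one_le_linkDeriv (kern_self_nonneg w)))
    (one_le_linkDeriv (kern_self_nonneg w)) (by positivity) ?_
  calc (1 + 2 * ‖w‖ ^ 2) * √(disc w w) ≤ 5 * (k : ℝ) ^ 2 * (9 * (k : ℝ) ^ 2) :=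
        mul_le_mul (one_add_two_norm_sq_le hk hR hsR) (sqrt_disc_self_le hk hR hsR) (by positivity)
          (by positivity)
    _ = 45 * (k : ℝ) ^ 4 := by ring

lemma selfCoeff_le (hk : 1 ≤ (k : ℝ)) : selfCoeff k w ≤ 4 * k := by
  have h := linkDeriv_le hk (kern_self_nonneg w) (kern_le_one w w)
  refine (div_le_self (zero_le_one.trans (one_le_linkDeriv (kern_self_nonneg w))) ?_).trans h
  exact one_le_mul_of_one_le_of_one_le (by nlinarith [sq_nonneg ‖w‖]) (one_le_sqrt_disc w w)

lemma pullCoeff_pos (ht : 0 < ⟪w, u⟫) : 0 < pullCoeff k u w :=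
  div_pos (zero_lt_one.trans_le (one_le_linkDeriv (kern_nonneg ht.le)))
    (Real.sqrt_pos.2 (disc_pos w u))

lemma pullCoeff_le (hk : 1 ≤ (k : ℝ)) (ht : 0 < ⟪w, u⟫) : pullCoeff k u w ≤ 4 * k :=
  (div_le_self (zero_le_one.trans (one_le_linkDeriv (kern_nonneg ht.le)))
    (one_le_sqrt_disc w u)).trans (linkDeriv_le hk (kern_nonneg ht.le) (kern_le_one w u))

lemma decayCoeff_ge (hk : 1 ≤ (k : ℝ)) (hR : ‖u‖ ^ 2 ≤ 2 * (k : ℝ) ^ 2)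
    (hsR : ‖w‖ ^ 2 ≤ ‖u‖ ^ 2) (ht : 0 < ⟪w, u⟫) : 1 / (45 * (k : ℝ) ^ 4) ≤ decayCoeff k u w := by
  have h1 := selfCoeff_ge hk hR hsR
  have h2 := pullCoeff_pos (k := k) ht
  have h3 : 0 ≤ 2 * ⟪w, u⟫ / (1 + 2 * ‖w‖ ^ 2) * pullCoeff k u w := by positivity
  rw [decayCoeff]
  linarith

lemma decayCoeff_le (hk : 1 ≤ (k : ℝ)) (hR : ‖u‖ ^ 2 ≤ 2 * (k : ℝ) ^ 2)
    (hsR : ‖w‖ ^ 2 ≤ ‖u‖ ^ 2) (ht : 0 < ⟪w, u⟫) : decayCoeff k u w ≤ 20 * (k : ℝ) ^ 3 := by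
  have h1 := selfCoeff_le (w := w) hk
  have h2 := pullCoeff_pos (k := k) ht
  have h3 := pullCoeff_le hk ht
  have h4 : 2 * ⟪w, u⟫ / (1 + 2 * ‖w‖ ^ 2) ≤ 4 * (k : ℝ) ^ 2 :=
    (div_le_self (by positivity) (by nlinarith [sq_nonneg ‖w‖])).trans
      (by linarith [inner_le_norm_sq hsR])
  have h5 := mul_le_mul h4 h3 h2.le (by positivity)
  have h6 : (k : ℝ) ≤ (k : ℝ) ^ 3 := le_self_pow₀ hk (by norm_num)
  rw [decayCoeff]
  linarith [show 4 * (k : ℝ) ^ 2 * (4 * k) = 16 * (k : ℝ) ^ 3 by ring]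

lemma norm_scaledGrad_sq_le (hk : 1 ≤ (k : ℝ)) (hR : ‖u‖ ^ 2 ≤ 2 * (k : ℝ) ^ 2)
    (hsR : ‖w‖ ^ 2 ≤ ‖u‖ ^ 2) (ht : 0 < ⟪w, u⟫) :
    ‖scaledGrad k u w‖ ^ 2 ≤ 1152 * (k : ℝ) ^ 8 := by
  have hwu : ‖w‖ ≤ ‖u‖ := le_of_sq_le_sq hsR (norm_nonneg _)
  have hA := decayCoeff_le hk hR hsR ht
  have hA0 : 0 ≤ decayCoeff k u w := (by positivity : 0 ≤ 1 / (45 * (k : ℝ) ^ 4)).trans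
    (decayCoeff_ge hk hR hsR ht)
  have hQ := pullCoeff_le hk ht
  have hQ0 := pullCoeff_pos (k := k) ht
  have h6 : (k : ℝ) ≤ (k : ℝ) ^ 3 := le_self_pow₀ hk (by norm_num)
  have h1 : ‖scaledGrad k u w‖ ≤ 24 * (k : ℝ) ^ 3 * ‖u‖ := by
    refine (norm_sub_le _ _).trans ?_
    rw [norm_smul, norm_smul, Real.norm_of_nonneg hA0, Real.norm_of_nonneg hQ0.le]
    have h2 := mul_le_mul hA hwu (norm_nonneg _) (by positivity)
    have h3 := mul_le_mul_of_nonneg_right (hQ.trans (mul_le_mul_of_nonneg_left h6 (by norm_num)))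
      (norm_nonneg u)
    linarith
  calc ‖scaledGrad k u w‖ ^ 2 ≤ (24 * (k : ℝ) ^ 3 * ‖u‖) ^ 2 :=
        pow_le_pow_left₀ (norm_nonneg _) h1 2
    _ = 576 * (k : ℝ) ^ 6 * ‖u‖ ^ 2 := by ring
    _ ≤ 576 * (k : ℝ) ^ 6 * (2 * (k : ℝ) ^ 2) := by gcongr
    _ = 1152 * (k : ℝ) ^ 8 := by ring

lemma kern_self_sub_kern_le (hk : 1 ≤ (k : ℝ)) (hR : ‖u‖ ^ 2 ≤ 2 * (k : ℝ) ^ 2)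
    (hsR : ‖w‖ ^ 2 ≤ ‖u‖ ^ 2) (hw : 0 < ‖w‖ ^ 2) (hst : ‖w‖ ^ 2 ≤ ⟪w, u⟫) :
    kern w w - kern w u ≤ 20 * (k : ℝ) ^ 2 * gram w u := by
  have hΔ := gram_nonneg w u
  have h0 : 0 ≤ 20 * (k : ℝ) ^ 2 * gram w u := by positivity
  have h1 := div_sub_div_le_gram hw hst hΔ (by rw [gram]; ring) (one_le_sqrt_disc w w)
    ((Real.sq_sqrt (disc_pos w w).le).trans (disc_self w)) (one_le_sqrt_disc w u)
    ((Real.sq_sqrt (disc_pos w u).le).trans (disc_eq w u))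
  have h2 : 2 * (1 + 2 * ‖w‖ ^ 2) * gram w u ≤ 2 * (5 * (k : ℝ) ^ 2) * gram w u := by
    gcongr
    exact one_add_two_norm_sq_le hk hR hsR
  rw [kern_eq, kern_eq, ← mul_sub, real_inner_self_eq_norm_sq]
  have h3 : 2 / Real.pi ≤ 1 := (div_le_one Real.pi_pos).2 (by linarith [Real.pi_gt_three])
  have h4 : Real.arctan (2 * ‖w‖ ^ 2 / √(disc w w)) - Real.arctan (2 * ⟪w, u⟫ / √(disc w u)) ≤
      20 * (k : ℝ) ^ 2 * gram w u := by
    rcases le_total (2 * ⟪w, u⟫ / √(disc w u)) (2 * ‖w‖ ^ 2 / √(disc w w)) with h | h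
    · refine (arctan_sub_arctan_le h).trans ?_
      rw [mul_div_assoc, mul_div_assoc]
      linarith
    · linarith [Real.arctan_mono h]
  calc 2 / Real.pi * _ ≤ 2 / Real.pi * (20 * (k : ℝ) ^ 2 * gram w u) :=
        mul_le_mul_of_nonneg_left h4 (by positivity)
    _ ≤ _ := mul_le_of_le_one_left h0 h3

/-- Here both contributions to the inner product are nonnegative. They dominate multiples of `‖w‖² -
⟪w, u⟫` and `‖u‖² - ⟪w, u⟫`, whose sum is `‖w - u‖²`. -/
lemma inner_scaledGrad_ge_of_inner_le (hk : 1 ≤ (k : ℝ)) (hR : ‖u‖ ^ 2 ≤ 2 * (k : ℝ) ^ 2)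
    (hsR : ‖w‖ ^ 2 ≤ ‖u‖ ^ 2) (ht : 0 < ⟪w, u⟫) (hts : ⟪w, u⟫ ≤ ‖w‖ ^ 2) :
    1 / (45 * (k : ℝ) ^ 4) * ‖w - u‖ ^ 2 ≤ ⟪scaledGrad k u w, w - u⟫ := by
  have hΔ := gram_nonneg w u
  have hs1 : 0 < 1 + 2 * ‖w‖ ^ 2 := by positivity
  have hsk := one_add_two_norm_sq_le hk hR hsR
  have hP := selfCoeff_ge hk hR hsR
  have hb := one_le_linkDeriv (k := k) (kern_nonneg ht.le)
  have hσ := one_le_sqrt_disc w u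
  have hσk := sqrt_disc_le hk hR hsR
  have hσ0 : 0 < √(disc w w) := Real.sqrt_pos.2 (disc_pos w w)
  have e : ⟪scaledGrad k u w, w - u⟫ = selfCoeff k w * (‖w‖ ^ 2 - ⟪w, u⟫) +
      linkDeriv k (kern w u) * (‖u‖ ^ 2 - ⟪w, u⟫ + 2 * gram w u) /
        (√(disc w u) * (1 + 2 * ‖w‖ ^ 2)) := by
    rw [inner_scaledGrad_eq, selfCoeff]
    field_simp
    ring
  have h1 : 1 / (45 * (k : ℝ) ^ 4) * (‖w‖ ^ 2 - ⟪w, u⟫) ≤ selfCoeff k w * (‖w‖ ^ 2 - ⟪w, u⟫) :=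
    mul_le_mul_of_nonneg_right hP (by linarith)
  have h2 : 1 / (45 * (k : ℝ) ^ 4) * (‖u‖ ^ 2 - ⟪w, u⟫) ≤
      linkDeriv k (kern w u) * (‖u‖ ^ 2 - ⟪w, u⟫ + 2 * gram w u) /
        (√(disc w u) * (1 + 2 * ‖w‖ ^ 2)) := by
    rw [div_mul_eq_mul_div, one_mul]
    refine div_le_div₀ (mul_nonneg (by linarith) (by linarith)) ?_ (by positivity) ?_
    · nlinarith
    · calc √(disc w u) * (1 + 2 * ‖w‖ ^ 2) ≤ 5 * (k : ℝ) ^ 2 * (5 * (k : ℝ) ^ 2) :=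
            mul_le_mul hσk hsk hs1.le (by positivity)
        _ ≤ 45 * (k : ℝ) ^ 4 := by nlinarith [pow_nonneg (zero_le_one.trans hk) 4]
  rw [e, norm_sub_sq_real]
  linarith

/-- Now the self-correlation term pushes the wrong way. Writing `b X - a Y = b (X - Y) - (a - b) Y`,
with `b` and `a` the link derivatives at `kern w u` and `kern w w`, `div_sub_div_margin` bounds `X -
Y` below by a multiple of `‖w - u‖²`, while `a - b` is at most a multiple of the Gram determinant.
-/
lemma inner_scaledGrad_ge_of_le_inner (hk : 1 ≤ (k : ℝ)) (hR : ‖u‖ ^ 2 ≤ 2 * (k : ℝ) ^ 2)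
    (hsR : ‖w‖ ^ 2 ≤ ‖u‖ ^ 2) (ht : 0 < ⟪w, u⟫) (hst : ‖w‖ ^ 2 ≤ ⟪w, u⟫) :
    1 / (2250 * (k : ℝ) ^ 8) * ‖w - u‖ ^ 2 - 40 * (k : ℝ) ^ 6 * gram w u ≤
      ⟪scaledGrad k u w, w - u⟫ := by
  have hw0 : w ≠ 0 := by
    rintro rfl
    simp at ht
  have hw : 0 < ‖w‖ ^ 2 := by positivity
  have hk0 : 0 < (k : ℝ) := by linarith
  have hΔ := gram_nonneg w u
  have hs1 : 1 ≤ 1 + 2 * ‖w‖ ^ 2 := by linarith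
  have hsk := one_add_two_norm_sq_le hk hR hsR
  have hS := one_le_sqrt_disc w w
  have hσ := one_le_sqrt_disc w u
  have hσk := sqrt_disc_le hk hR hsR
  have hS2 := (Real.sq_sqrt (disc_pos w w).le).trans (disc_self w)
  have hS2k : √(disc w w) ^ 2 ≤ 9 * (k : ℝ) ^ 2 := by
    rw [Real.sq_sqrt (disc_pos w w).le]
    exact disc_self_le hk hR hsR
  have hb := one_le_linkDeriv (k := k) (kern_nonneg ht.le)
  have hlink := linkDeriv_sub_le (k := k) (kern_self_nonneg w) (kern_le_one w w)
    (kern_nonneg ht.le) (kern_le_one w u) (by positivity)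
    (kern_self_sub_kern_le hk hR hsR hw hst)
  have hmargin := div_sub_div_margin hw.le (sub_nonneg.2 hst) (sq_nonneg ‖w - u‖) hΔ
    (norm_sub_sq_mul_norm_sq w u) (by linarith) hS2 (by linarith)
    ((Real.sq_sqrt (disc_pos w u).le).trans (disc_eq_add w u))
  have hq : ‖u‖ ^ 2 - ⟪w, u⟫ + 2 * gram w u =
      ⟪w, u⟫ - ‖w‖ ^ 2 + ‖w - u‖ ^ 2 + 2 * gram w u := by
    rw [norm_sub_sq_real]
    ring
  rw [inner_scaledGrad_eq, hq]
  have hden : 2 * √(disc w u) * √(disc w w) ^ 2 * (1 + 2 * ‖w‖ ^ 2) ≤ 450 * (k : ℝ) ^ 6 := by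
    calc 2 * √(disc w u) * √(disc w w) ^ 2 * (1 + 2 * ‖w‖ ^ 2)
        ≤ 2 * (5 * (k : ℝ) ^ 2) * (9 * (k : ℝ) ^ 2) * (5 * (k : ℝ) ^ 2) := by gcongr
      _ = 450 * (k : ℝ) ^ 6 := by ring
  have hN : ‖w - u‖ ^ 2 / (450 * (k : ℝ) ^ 6) ≤
      ‖w - u‖ ^ 2 / (2 * √(disc w u) * √(disc w w) ^ 2 * (1 + 2 * ‖w‖ ^ 2)) :=
    div_le_div_of_nonneg_left (sq_nonneg _) (by positivity) hden
  have hN0 : 0 ≤ ‖w - u‖ ^ 2 / (450 * (k : ℝ) ^ 6) := by positivity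
  have hqS0 : 0 ≤ (⟪w, u⟫ - ‖w‖ ^ 2) / √(disc w w) := div_nonneg (by linarith) (by linarith)
  have hqS : (⟪w, u⟫ - ‖w‖ ^ 2) / √(disc w w) ≤ 2 * (k : ℝ) ^ 2 :=
    (div_le_self (by linarith) hS).trans (by linarith [inner_le_norm_sq hsR])
  set X := (⟪w, u⟫ - ‖w‖ ^ 2 + ‖w - u‖ ^ 2 + 2 * gram w u) / √(disc w u)
  set Y := (⟪w, u⟫ - ‖w‖ ^ 2) / √(disc w w)
  have h1 : X - Y ≤ linkDeriv k (kern w u) * (X - Y) :=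
    le_mul_of_one_le_left (by linarith) hb
  have h2 : linkDeriv k (kern w w) * Y - linkDeriv k (kern w u) * Y ≤
      40 * (k : ℝ) ^ 6 * gram w u := by
    calc linkDeriv k (kern w w) * Y - linkDeriv k (kern w u) * Y
        = (linkDeriv k (kern w w) - linkDeriv k (kern w u)) * Y := by ring
      _ ≤ (k : ℝ) ^ 2 * (20 * (k : ℝ) ^ 2 * gram w u) * Y :=
        mul_le_mul_of_nonneg_right hlink hqS0
      _ ≤ (k : ℝ) ^ 2 * (20 * (k : ℝ) ^ 2 * gram w u) * (2 * (k : ℝ) ^ 2) :=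
        mul_le_mul_of_nonneg_left hqS (by positivity)
      _ = 40 * (k : ℝ) ^ 6 * gram w u := by ring
  have h3 : ‖w - u‖ ^ 2 / (450 * (k : ℝ) ^ 6) - 40 * (k : ℝ) ^ 6 * gram w u ≤
      linkDeriv k (kern w u) * X - linkDeriv k (kern w w) * Y := by linarith
  have h4 := div_le_div_of_nonneg_right h3 (zero_le_one.trans hs1)
  refine le_trans ?_ h4
  rw [sub_div]
  have h5 : 1 / (2250 * (k : ℝ) ^ 8) * ‖w - u‖ ^ 2 ≤
      ‖w - u‖ ^ 2 / (450 * (k : ℝ) ^ 6) / (1 + 2 * ‖w‖ ^ 2) := by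
    refine le_trans (le_of_eq ?_) (div_le_div_of_nonneg_left hN0 (by linarith) hsk)
    field_simp
    ring
  have h6 : 40 * (k : ℝ) ^ 6 * gram w u / (1 + 2 * ‖w‖ ^ 2) ≤ 40 * (k : ℝ) ^ 6 * gram w u :=
    div_le_self (by positivity) hs1
  linarith

lemma inner_scaledGrad_ge (hk : 1 ≤ (k : ℝ)) (hR : ‖u‖ ^ 2 ≤ 2 * (k : ℝ) ^ 2)
    (hsR : ‖w‖ ^ 2 ≤ ‖u‖ ^ 2) (ht : 0 < ⟪w, u⟫) :
    1 / (2250 * (k : ℝ) ^ 8) * ‖w - u‖ ^ 2 - 40 * (k : ℝ) ^ 6 * gram w u ≤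
      ⟪scaledGrad k u w, w - u⟫ := by
  rcases le_total (‖w‖ ^ 2) ⟪w, u⟫ with h | h
  · exact inner_scaledGrad_ge_of_le_inner hk hR hsR ht h
  · refine le_trans ?_ (inner_scaledGrad_ge_of_inner_le hk hR hsR ht h)
    have hΔ := gram_nonneg w u
    have h1 : 0 ≤ 40 * (k : ℝ) ^ 6 * gram w u := by positivity
    have h2 : 1 / (2250 * (k : ℝ) ^ 8) * ‖w - u‖ ^ 2 ≤ 1 / (45 * (k : ℝ) ^ 4) * ‖w - u‖ ^ 2 := by
      gcongr
      · norm_num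
      · norm_num
    linarith

end Bounds

/-! ### One gradient step and the Lyapunov function -/

/-- The Lyapunov function of projected gradient descent: the squared distance to the target plus a
multiple of the Gram determinant, which contracts at every step. -/
def lyapunov {d : ℕ} (k : ℕ) (u w : Vec d) : ℝ := ‖w - u‖ ^ 2 + 7200 * (k : ℝ) ^ 10 * gram w u

lemma gdStep_eq {d k : ℕ} [NeZero k] (h : ℝ) (u w : Vec d) :
    gdStep k (h * (Real.pi / 4)) u w = w - h • scaledGrad k u w := by
  have : Real.pi ≠ 0 := Real.pi_ne_zero
  rw [gdStep, gradient_objective, smul_smul]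
  congr 2
  field_simp

/-- The Gram determinant is a squared area: shearing along `u` leaves it unchanged. -/
lemma gram_smul_add_smul {d : ℕ} (a b : ℝ) (u w : Vec d) :
    gram (a • w + b • u) u = a ^ 2 * gram w u := by
  rw [gram, gram, ← real_inner_self_eq_norm_sq, ← real_inner_self_eq_norm_sq w,
    ← real_inner_self_eq_norm_sq u]
  simp only [inner_add_left, inner_add_right, real_inner_smul_left, real_inner_smul_right,
    real_inner_comm w u]
  ring

lemma gram_smul {d : ℕ} (a : ℝ) (u w : Vec d) : gram (a • w) u = a ^ 2 * gram w u := by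
  simpa using gram_smul_add_smul a 0 u w

section Step

variable {d k : ℕ} {u w : Vec d} {h : ℝ}

lemma sub_smul_scaledGrad :
    w - h • scaledGrad k u w = (1 - h * decayCoeff k u w) • w + (h * pullCoeff k u w) • u := by
  rw [scaledGrad, smul_sub, smul_smul, smul_smul, sub_smul, one_smul]
  abel

lemma inner_step_pos (hk : 1 ≤ (k : ℝ)) (hR : ‖u‖ ^ 2 ≤ 2 * (k : ℝ) ^ 2)
    (hsR : ‖w‖ ^ 2 ≤ ‖u‖ ^ 2) (ht : 0 < ⟪w, u⟫) (hh : 0 < h) (hhk : h * (20 * (k : ℝ) ^ 3) ≤ 1) :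
    0 < ⟪w - h • scaledGrad k u w, u⟫ := by
  have hA : h * decayCoeff k u w ≤ 1 :=
    (mul_le_mul_of_nonneg_left (decayCoeff_le hk hR hsR ht) hh.le).trans hhk
  have hu : u ≠ 0 := by
    rintro rfl
    simp at ht
  rw [sub_smul_scaledGrad, inner_add_left, real_inner_smul_left, real_inner_smul_left,
    real_inner_self_eq_norm_sq]
  have h1 : 0 < h * pullCoeff k u w * ‖u‖ ^ 2 := by
    have := pullCoeff_pos (k := k) ht
    positivity
  have h2 : 0 ≤ (1 - h * decayCoeff k u w) * ⟪w, u⟫ := mul_nonneg (by linarith) ht.le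
  linarith

/-- Expanding the squared distance leaves a Gram error of order `h`, which the decay of the weighted
Gram term absorbs; only the squared gradient norm, of order `h²`, remains. -/
lemma lyapunov_step_le (hk : 1 ≤ (k : ℝ)) (hR : ‖u‖ ^ 2 ≤ 2 * (k : ℝ) ^ 2)
    (hsR : ‖w‖ ^ 2 ≤ ‖u‖ ^ 2) (ht : 0 < ⟪w, u⟫) (hh : 0 < h) (hhk : h * (20 * (k : ℝ) ^ 3) ≤ 1) :
    lyapunov k u (w - h • scaledGrad k u w) ≤
      (1 - h / (1125 * (k : ℝ) ^ 8)) * lyapunov k u w + 1152 * (k : ℝ) ^ 8 * h ^ 2 := by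
  have hk0 : 0 < (k : ℝ) := by linarith
  have hΔ := gram_nonneg w u
  have hA : h * decayCoeff k u w ≤ 1 :=
    (mul_le_mul_of_nonneg_left (decayCoeff_le hk hR hsR ht) hh.le).trans hhk
  have hA' : h * (1 / (45 * (k : ℝ) ^ 4)) ≤ h * decayCoeff k u w :=
    mul_le_mul_of_nonneg_left (decayCoeff_ge hk hR hsR ht) hh.le
  have hA0 : 0 ≤ h * (1 / (45 * (k : ℝ) ^ 4)) := by positivity
  have h1 : gram (w - h • scaledGrad k u w) u ≤ (1 - h * (1 / (45 * (k : ℝ) ^ 4))) * gram w u := by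
    rw [sub_smul_scaledGrad, gram_smul_add_smul]
    refine mul_le_mul_of_nonneg_right ?_ hΔ
    -- Since `0 ≤ hA ≤ 1`, `(1 - hA)² ≤ 1 - hA`.
    nlinarith
  have h2 : ‖w - h • scaledGrad k u w - u‖ ^ 2 = ‖w - u‖ ^ 2 -
      2 * h * ⟪scaledGrad k u w, w - u⟫ + h ^ 2 * ‖scaledGrad k u w‖ ^ 2 := by
    rw [sub_right_comm, norm_sub_sq_real, real_inner_smul_right, norm_smul, mul_pow,
      Real.norm_eq_abs, sq_abs, real_inner_comm]
    ring
  have h3 := mul_le_mul_of_nonneg_left (inner_scaledGrad_ge hk hR hsR ht)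
    (by positivity : 0 ≤ 2 * h)
  have h4 := mul_le_mul_of_nonneg_left (norm_scaledGrad_sq_le hk hR hsR ht) (sq_nonneg h)
  have h5 := mul_le_mul_of_nonneg_left h1 (by positivity : 0 ≤ 7200 * (k : ℝ) ^ 10)
  have h6 : 2 * h * (1 / (2250 * (k : ℝ) ^ 8) * ‖w - u‖ ^ 2) =
      h / (1125 * (k : ℝ) ^ 8) * ‖w - u‖ ^ 2 := by
    field_simp
    ring
  -- The weight `7200 k^10` yields a decrease of `160 h k^6 gram`: half pays for the error `2h * 40
  -- k^6 gram`, the other half for contracting the Gram term itself (`h9`).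
  have h7 : 7200 * (k : ℝ) ^ 10 * (h * (1 / (45 * (k : ℝ) ^ 4)) * gram w u) =
      160 * h * (k : ℝ) ^ 6 * gram w u := by
    field_simp
    ring
  have h8 : h / (1125 * (k : ℝ) ^ 8) * (7200 * (k : ℝ) ^ 10 * gram w u) =
      32 / 5 * h * (k : ℝ) ^ 2 * gram w u := by
    field_simp
    ring
  have h9 : 32 / 5 * h * (k : ℝ) ^ 2 * gram w u ≤ 80 * h * (k : ℝ) ^ 6 * gram w u := by
    have : (k : ℝ) ^ 2 ≤ (k : ℝ) ^ 6 := pow_le_pow_right₀ hk (by norm_num)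
    have h10 : 32 / 5 * (k : ℝ) ^ 2 ≤ 80 * (k : ℝ) ^ 6 := by nlinarith
    nlinarith [mul_le_mul_of_nonneg_right h10 (mul_nonneg hh.le hΔ)]
  rw [lyapunov, lyapunov, h2]
  nlinarith

end Step

/-! ### Projection onto the ball -/

section Projection

variable {d k : ℕ} {u v : Vec d}

lemma norm_projBall_le {r : ℝ} (hr : 0 ≤ r) (v : Vec d) : ‖projBall r v‖ ≤ r := by
  rw [projBall]
  split_ifs with h
  · exact h
  · push Not at h
    have : 0 < ‖v‖ := hr.trans_lt h
    rw [norm_smul, Real.norm_of_nonneg (by positivity), div_mul_cancel₀ _ this.ne']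

lemma inner_projBall_pos (ht : 0 < ⟪v, u⟫) : 0 < ⟪projBall ‖u‖ v, u⟫ := by
  have hu : u ≠ 0 := by
    rintro rfl
    simp at ht
  have hv : v ≠ 0 := by
    rintro rfl
    simp at ht
  rw [projBall]
  split_ifs with h
  · exact ht
  · rw [real_inner_smul_left]
    positivity

/-- Rescaling by `ρ ≤ 1` multiplies the Gram determinant by `ρ²`, and since `u` lies on the sphere
of the ball, projecting brings the point no farther from `u`. -/
lemma lyapunov_projBall_le : lyapunov k u (projBall ‖u‖ v) ≤ lyapunov k u v := by
  rw [projBall]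
  split_ifs with h
  · exact le_rfl
  · push Not at h
    have hv : 0 < ‖v‖ := (norm_nonneg u).trans_lt h
    obtain ⟨ρ, hρ⟩ : ∃ ρ, ρ = ‖u‖ / ‖v‖ := ⟨_, rfl⟩
    have hρ0 : 0 ≤ ρ := hρ ▸ by positivity
    have hρ1 : ρ ≤ 1 := hρ ▸ (div_le_one hv).2 h.le
    have hu : ‖u‖ = ρ * ‖v‖ := by rw [hρ, div_mul_cancel₀ _ hv.ne']
    rw [← hρ, lyapunov, lyapunov, gram_smul]
    have h1 : ‖ρ • v - u‖ ^ 2 ≤ ‖v - u‖ ^ 2 := by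
      have h2 := real_inner_le_norm v u
      rw [hu] at h2
      rw [norm_sub_sq_real, norm_sub_sq_real, norm_smul, real_inner_smul_left,
        Real.norm_of_nonneg hρ0]
      nlinarith [mul_le_mul_of_nonneg_left h2 (sub_nonneg.2 hρ1), sq_nonneg ((1 - ρ) * ‖v‖)]
    have h3 : ρ ^ 2 * gram v u ≤ gram v u :=
      mul_le_of_le_one_left (gram_nonneg v u) (pow_le_one₀ hρ0 hρ1)
    have h4 := mul_le_mul_of_nonneg_left h3 (by positivity : 0 ≤ 7200 * (k : ℝ) ^ 10)
    linarith

end Projection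

/-! ### Iteration and choice of parameters -/

lemma lyapunov_le {d k : ℕ} {u w : Vec d} (hk : 1 ≤ (k : ℝ)) (hR : ‖u‖ ^ 2 ≤ 2 * (k : ℝ) ^ 2)
    (hwu : ‖w‖ ≤ ‖u‖) : lyapunov k u w ≤ 28808 * (k : ℝ) ^ 14 := by
  have h1 : ‖w - u‖ ^ 2 ≤ 8 * (k : ℝ) ^ 2 := by
    have := norm_sub_le w u
    nlinarith [norm_nonneg (w - u), norm_nonneg u]
  have h2 : gram w u ≤ 4 * (k : ℝ) ^ 4 := by
    have h3 : ‖w‖ ^ 2 ≤ 2 * (k : ℝ) ^ 2 := (pow_le_pow_left₀ (norm_nonneg _) hwu 2).trans hR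
    have h4 := mul_le_mul h3 hR (sq_nonneg _) (by positivity)
    rw [gram]
    nlinarith [sq_nonneg ⟪w, u⟫]
  have h5 : (k : ℝ) ^ 2 ≤ (k : ℝ) ^ 14 := pow_le_pow_right₀ hk (by norm_num)
  calc lyapunov k u w ≤ 8 * (k : ℝ) ^ 2 + 7200 * (k : ℝ) ^ 10 * (4 * (k : ℝ) ^ 4) :=
        add_le_add h1 (mul_le_mul_of_nonneg_left h2 (by positivity))
    _ = 8 * (k : ℝ) ^ 2 + 28800 * (k : ℝ) ^ 14 := by ring
    _ ≤ 28808 * (k : ℝ) ^ 14 := by linarith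

lemma projGdIter_succ {d k : ℕ} [NeZero k] (η : ℝ) (u w : Vec d) (t : ℕ) :
    projGdIter k η u w (t + 1) = projBall ‖u‖ (gdStep k η u (projGdIter k η u w t)) :=
  Function.iterate_succ_apply' _ _ _

lemma gdIter_succ {d k : ℕ} [NeZero k] (η : ℝ) (u w : Vec d) (t : ℕ) :
    gdIter k η u w (t + 1) = gdStep k η u (gdIter k η u w t) :=
  Function.iterate_succ_apply' _ _ _

lemma projGdIter_eq_gdIter {d k : ℕ} [NeZero k] {η : ℝ} {u w : Vec d} {T : ℕ}
    (h : ∀ t ≤ T, ‖gdIter k η u w t‖ ≤ ‖u‖) : ∀ t ≤ T, projGdIter k η u w t = gdIter k η u w t := by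
  intro t
  induction t with
  | zero => exact fun _ => rfl
  | succ t ih =>
    intro ht
    have h1 := h (t + 1) ht
    rw [gdIter_succ] at h1
    rw [projGdIter_succ, gdIter_succ, ih (by omega), projBall, if_pos h1]

/-- `B` is the fixed point of `V ↦ (1 - x) V + x B`, so the bound after `n` steps is a convex
combination of the initial value and `B`. -/
lemma projGdIter_invariant {d k : ℕ} [NeZero k] {u w : Vec d} {h : ℝ} (hk : 1 ≤ (k : ℝ))
    (hR : ‖u‖ ^ 2 ≤ 2 * (k : ℝ) ^ 2) (hw : ‖w‖ ≤ ‖u‖) (ht : 0 < ⟪w, u⟫) (hh : 0 < h)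
    (hhk : h * (20 * (k : ℝ) ^ 3) ≤ 1) {x B : ℝ} (hx : x = h / (1125 * (k : ℝ) ^ 8))
    (hx1 : x ≤ 1) (hB : 1152 * (k : ℝ) ^ 8 * h ^ 2 = x * B) (n : ℕ) :
    ‖projGdIter k (h * (Real.pi / 4)) u w n‖ ≤ ‖u‖ ∧
      0 < ⟪projGdIter k (h * (Real.pi / 4)) u w n, u⟫ ∧
      lyapunov k u (projGdIter k (h * (Real.pi / 4)) u w n) ≤
        (1 - x) ^ n * lyapunov k u w + (1 - (1 - x) ^ n) * B := by
  induction n with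
  | zero => exact ⟨hw, ht, by simp [projGdIter]⟩
  | succ n ih =>
    obtain ⟨h1, h2, h3⟩ := ih
    rw [projGdIter_succ, gdStep_eq]
    have h1' := pow_le_pow_left₀ (norm_nonneg _) h1 2
    refine ⟨norm_projBall_le (norm_nonneg u) _,
      inner_projBall_pos (inner_step_pos hk hR h1' h2 hh hhk), lyapunov_projBall_le.trans
        ((lyapunov_step_le hk hR h1' h2 hh hhk).trans ?_)⟩
    rw [← hx, hB]
    have h4 := mul_le_mul_of_nonneg_left h3 (sub_nonneg.2 hx1)
    rw [pow_succ]
    linarith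

/-- Multiply by `(1 + x)^n`, which is at least `n x` by Bernoulli, and use `(1 - x²)^n ≤ 1`. This
rate already gives a polynomial iteration count. -/
lemma one_sub_pow_le {x : ℝ} (hx : 0 < x) (hx1 : x ≤ 1) {n : ℕ} (hn : 0 < n) :
    (1 - x) ^ n ≤ 1 / (n * x) := by
  have hn' : (0 : ℝ) < n := by exact_mod_cast hn
  rw [le_div_iff₀ (by positivity)]
  have h1 : 1 + n * x ≤ (1 + x) ^ n := one_add_mul_le_pow (by linarith) n
  have h0 : 0 ≤ (1 - x) ^ n := pow_nonneg (by linarith) n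
  calc (1 - x) ^ n * (n * x) ≤ (1 - x) ^ n * (1 + x) ^ n :=
        mul_le_mul_of_nonneg_left (by linarith) h0
    _ = (1 - x ^ 2) ^ n := by rw [← mul_pow]; ring
    _ ≤ 1 := pow_le_one₀ (by nlinarith) (by nlinarith)

/-- Projected gradient descent with a step of order `k⁻¹⁶ M⁻²` reaches a point at distance at most
`M⁻¹` from the target. -/
lemma norm_projGdIter_sub_le {d k : ℕ} [NeZero k] {u w : Vec d} {h M : ℝ} (hk : 1 ≤ (k : ℝ))
    (hM : 1 ≤ M) (hR : ‖u‖ ^ 2 ≤ 2 * (k : ℝ) ^ 2) (hw : ‖w‖ ≤ ‖u‖) (ht : 0 < ⟪w, u⟫)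
    (hh : h = 1 / (2592000 * (k : ℝ) ^ 16 * M ^ 2)) {T : ℕ}
    (hT : 57616 * 1125 * 2592000 * (k : ℝ) ^ 38 * M ^ 4 ≤ T) :
    ‖projGdIter k (h * (Real.pi / 4)) u w T - u‖ ≤ 1 / M := by
  have hk0 : 0 < (k : ℝ) := by linarith
  have hM0 : 0 < M := by linarith
  have hh0 : 0 < h := by rw [hh]; positivity
  have hden : 2592000 * (k : ℝ) ^ 3 ≤ 2592000 * (k : ℝ) ^ 16 * M ^ 2 := by
    have h1 : (k : ℝ) ^ 3 ≤ (k : ℝ) ^ 16 := pow_le_pow_right₀ hk (by norm_num)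
    have h2 : (k : ℝ) ^ 16 ≤ (k : ℝ) ^ 16 * M ^ 2 :=
      le_mul_of_one_le_right (by positivity) (one_le_pow₀ hM)
    linarith
  have hhk : h * (20 * (k : ℝ) ^ 3) ≤ 1 := by
    rw [hh, one_div_mul_eq_div, div_le_one (by positivity)]
    nlinarith [pow_pos hk0 3]
  have hk3 : 1 ≤ (k : ℝ) ^ 3 := one_le_pow₀ hk
  have hx1 : h / (1125 * (k : ℝ) ^ 8) ≤ 1 := by
    rw [div_le_one (by positivity)]
    have : 1 ≤ (k : ℝ) ^ 8 := one_le_pow₀ hk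
    nlinarith
  have hx0 : 0 < h / (1125 * (k : ℝ) ^ 8) := by positivity
  -- The step size is chosen for this: `2592000 = 2 * 1152 * 1125` makes the noise floor exactly `1
  -- / (2M²)`, half of the target squared error.
  have hB : 1152 * (k : ℝ) ^ 8 * h ^ 2 = h / (1125 * (k : ℝ) ^ 8) * (1 / (2 * M ^ 2)) := by
    rw [hh]
    field_simp
    norm_num
  have hT0 : (0 : ℝ) < T := lt_of_lt_of_le (by positivity) hT
  have hinv := (projGdIter_invariant hk hR hw ht hh0 hhk rfl hx1 hB T).2.2
  have hV := lyapunov_le hk hR hw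
  have hpow := one_sub_pow_le hx0 hx1 (n := T) (by exact_mod_cast hT0)
  have hpow0 : 0 ≤ (1 - h / (1125 * (k : ℝ) ^ 8)) ^ T := pow_nonneg (by linarith) T
  have h1 : (1 - h / (1125 * (k : ℝ) ^ 8)) ^ T * lyapunov k u w ≤ 1 / (2 * M ^ 2) := by
    calc _ ≤ 1 / (T * (h / (1125 * (k : ℝ) ^ 8))) * (28808 * (k : ℝ) ^ 14) :=
          (mul_le_mul_of_nonneg_left hV hpow0).trans
            (mul_le_mul_of_nonneg_right hpow (by positivity))
      _ ≤ 1 / (2 * M ^ 2) := by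
          rw [one_div_mul_eq_div, div_le_div_iff₀ (by positivity) (by positivity), hh, one_mul]
          -- The threshold for `T` is the initial bound `28808 k^14` times `2M²`, divided by the
          -- contraction rate; hence `57616 = 2 * 28808` and `38 = 14 + 16 + 8`.
          have h2 : 28808 * (k : ℝ) ^ 14 * (2 * M ^ 2) =
              57616 * 1125 * 2592000 * (k : ℝ) ^ 38 * M ^ 4 *
                (1 / (2592000 * (k : ℝ) ^ 16 * M ^ 2) / (1125 * (k : ℝ) ^ 8)) := by
            field_simp
            norm_num
          rw [h2]
          exact mul_le_mul_of_nonneg_right hT (by positivity)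
  have h2 : (1 - (1 - h / (1125 * (k : ℝ) ^ 8)) ^ T) * (1 / (2 * M ^ 2)) ≤ 1 / (2 * M ^ 2) :=
    mul_le_of_le_one_left (by positivity) (by linarith)
  have h3 : ‖projGdIter k (h * (Real.pi / 4)) u w T - u‖ ^ 2 ≤ (1 / M) ^ 2 := by
    have h4 : 0 ≤ 7200 * (k : ℝ) ^ 10 * gram (projGdIter k (h * (Real.pi / 4)) u w T) u :=
      mul_nonneg (by positivity) (gram_nonneg _ _)
    have h5 : 1 / (2 * M ^ 2) + 1 / (2 * M ^ 2) = (1 / M) ^ 2 := by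
      field_simp
      norm_num
    rw [lyapunov] at hinv
    linarith
  exact le_of_sq_le_sq h3 (by positivity)

end WeightSharing

end

theorem mainTheorem2 :
    ∃ (C : ℝ) (m : ℕ), ∀ (k : ℕ) [NeZero k] (ε : ℝ), 0 < ε →
      ∃ (η : ℝ) (T : ℕ), 0 < η ∧ (T : ℝ) ≤ C * ((k : ℝ) + 1 / ε) ^ m ∧
        ∀ (d : ℕ) (u₀ w : WeightSharing.Vec d),
          ‖u₀‖ ^ 2 = 12 / Real.pi ^ 2 * (k : ℝ) ^ 2 →
          0 < inner ℝ w u₀ →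
          (‖w‖ ≤ ‖u₀‖ → ‖WeightSharing.projGdIter k η u₀ w T - u₀‖ ≤ ε) ∧
          ((∀ t ≤ T, ‖WeightSharing.gdIter k η u₀ w t‖ ≤ ‖u₀‖) →
            ‖WeightSharing.gdIter k η u₀ w T - u₀‖ ≤ ε) := by
  -- The exponent is `38 + 4`, as `M = k + 1/ε` dominates `k`; the extra `1` in the constant absorbs
  -- the ceiling in `T`.
  refine ⟨57616 * 1125 * 2592000 + 1, 42, fun k _ ε hε => ?_⟩
  have hk : 1 ≤ (k : ℝ) := by exact_mod_cast NeZero.one_le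
  obtain ⟨M, hM⟩ : ∃ M : ℝ, M = k + 1 / ε := ⟨_, rfl⟩
  have hε' : 0 < 1 / ε := by positivity
  have hkM : (k : ℝ) ≤ M := by linarith
  have hM1 : 1 ≤ M := by linarith
  have hM0 : 0 < M := by linarith
  have hMε : 1 / M ≤ ε := by
    rw [div_le_comm₀ hM0 hε]
    linarith
  obtain ⟨h, hh⟩ : ∃ h : ℝ, h = 1 / (2592000 * (k : ℝ) ^ 16 * M ^ 2) := ⟨_, rfl⟩
  have hh0 : 0 < h := by rw [hh]; positivity
  refine ⟨h * (Real.pi / 4), ⌈57616 * 1125 * 2592000 * (k : ℝ) ^ 38 * M ^ 4⌉₊, by positivity, ?_,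
    fun d u w hu ht => ?_⟩
  · rw [← hM]
    refine (Nat.ceil_lt_add_one (by positivity)).le.trans ?_
    have h1 : (k : ℝ) ^ 38 * M ^ 4 ≤ M ^ 42 := by
      calc (k : ℝ) ^ 38 * M ^ 4 ≤ M ^ 38 * M ^ 4 := by gcongr
        _ = M ^ 42 := by ring
    have h2 : 1 ≤ M ^ 42 := one_le_pow₀ hM1
    linarith
  -- The prescribed norm enters only through this bound, which holds since `π > 3` gives `12/π² ≤
  -- 2`.
  · have hR : ‖u‖ ^ 2 ≤ 2 * (k : ℝ) ^ 2 := by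
      rw [hu]
      refine mul_le_mul_of_nonneg_right ?_ (by positivity)
      rw [div_le_iff₀ (by positivity)]
      nlinarith [Real.pi_gt_three]
    have key : ‖w‖ ≤ ‖u‖ → ‖WeightSharing.projGdIter k (h * (Real.pi / 4)) u w
        ⌈57616 * 1125 * 2592000 * (k : ℝ) ^ 38 * M ^ 4⌉₊ - u‖ ≤ ε := fun hw =>
      (WeightSharing.norm_projGdIter_sub_le hk hM1 hR hw ht hh (Nat.le_ceil _)).trans hMε
    refine ⟨key, fun hT => ?_⟩
    rw [← WeightSharing.projGdIter_eq_gdIter hT _ le_rfl]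
    exact key (hT 0 (Nat.zero_le _))
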